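/- Let $p$ be a prime and let $\Psi=(\psi_1,\dots,\psi_t)$ be a system of linear forms $\psi_i:\mathbb F_p^D\to\mathbb F_p$. Suppose that $\Psi$ is a rank-two system of linear equations, i.e. that its image in $\mathbb F_p^t$ is the kernel of a $2\times t$ matrix $M$ of rank $2$ over $\mathbb F_p$, and that it is *linearly generic*, i.e. every $2\times 2$ minor of $M$ is nonzero. For $n\ge 1$ and $f:\mathbb F_p^n\to\mathbb R$ put $T_\Psi(f)=\mathbb E_{x_1,\dots,x_D\in\mathbb F_p^n}\prod_{i=1}^t f(\psi_i(x_1,\dots,x_D))$, where $\psi_i$ acts coordinatewise on $(\mathbb F_p^n)^D$ and $\mathbb E$ denotes the average. The system $\Psi$ is - *Sidorenko* if $T_\Psi(f)\ge(\mathbb E f)^t$ for all $n\ge1$ and all $f:\mathbb F_p^n\to[0,1]$; - *locally Sidorenko* if for every $\alpha\in[0,1]$ there is $\varepsilon>0$ such that for all $n\ge1$ and all $f:\mathbb F_p^n\to[-\alpha,1-\alpha]$ with $\mathbb E f=0$ we have $T_\Psi(\alpha+\varepsilon f)\ge\alpha^t$; - *weakly locally Sidorenko* if for all $n\ge1$,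 all $\alpha\in[0,1]$ and all $f:\mathbb F_p^n\to[-\alpha,1-\alpha]$ with $\mathbb E f=0$ there is $\varepsilon_f>0$ such that $T_\Psi(\alpha+\varepsilon f)\ge\alpha^t$ for all $0<\varepsilon<\varepsilon_f$. We say that $\Psi$ *contains an additive $k$-tuple* if there are distinct indices $i_1,\dots,i_k$ such that the image of $(\psi_{i_1},\dots,\psi_{i_k})$ is $\{y\in\mathbb F_p^k: y_1-y_2+y_3-\cdots+(-1)^{k+1}y_k=0\}$. Then: 1. $\Psi$ is not locally Sidorenko, and not Sidorenko, unless $t=3$ and $\Psi$ is the trivial system $x_1=x_2=x_3$ (that is, $\psi_1=\psi_2=\psi_3$). 2. If $\Psi$ is weakly locally Sidorenko, then $t$ is odd, and if furthermore $p\ge p_0(t)$, where $p_0(t)$ depends only on $t$, then $\Psi$ contains an additive $(t-1)$-tuple. -/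

import Mathlib

open scoped BigOperators

/-- A system `Ψ = (ψ₁, …, ψ_t)` of `t` linear forms, each mapping `𝔽_p^D` to `𝔽_p`. -/
abbrev LinFormSystem (p t D : ℕ) : Type :=
  Fin t → Module.Dual (ZMod p) (Fin D → ZMod p)

namespace LinFormSystem

variable {p t D : ℕ}

/-- The map `(𝔽_p^n)^D → 𝔽_p^n` induced by a linear form `ψ : 𝔽_p^D → 𝔽_p`: apply `ψ` in each of
the `n` coordinates. -/
def induced (ψ : Module.Dual (ZMod p) (Fin D → ZMod p)) (n : ℕ)
    (x : Fin D → (Fin n → ZMod p)) : Fin n → ZMod p :=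
  fun k => ψ (fun d => x d k)

/-- `T_Ψ(f) = 𝔼_{x₁, …, x_D ∈ 𝔽_p^n} f(ψ₁(x₁, …, x_D)) ⋯ f(ψ_t(x₁, …, x_D))`, for real-valued `f`;
here `𝔼` is the normalised sum. -/
noncomputable def T [NeZero p] (Ψ : LinFormSystem p t D) (n : ℕ)
    (f : (Fin n → ZMod p) → ℝ) : ℝ :=
  𝔼 x : Fin D → (Fin n → ZMod p), ∏ i, f (induced (Ψ i) n x)

/-- `Ψ` is Sidorenko: `T_Ψ(f) ≥ (𝔼 f)^t` for all `n ≥ 1` and `f : 𝔽_p^n → [0,1]`. -/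
def IsSidorenko [NeZero p] (Ψ : LinFormSystem p t D) : Prop :=
  ∀ n : ℕ, 1 ≤ n → ∀ f : (Fin n → ZMod p) → ℝ, (∀ x, f x ∈ Set.Icc (0 : ℝ) 1) →
    (𝔼 x, f x) ^ t ≤ T Ψ n f

/-- `Ψ` is locally Sidorenko: the radius `ε` depends on `α` only. -/
def IsLocallySidorenko [NeZero p] (Ψ : LinFormSystem p t D) : Prop :=
  ∀ α ∈ Set.Icc (0 : ℝ) 1, ∃ ε : ℝ, 0 < ε ∧
    ∀ n : ℕ, 1 ≤ n → ∀ f : (Fin n → ZMod p) → ℝ,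
      (∀ x, f x ∈ Set.Icc (-α) (1 - α)) → 𝔼 x, f x = 0 →
        α ^ t ≤ T Ψ n (fun x => α + ε * f x)

/-- `Ψ` is weakly locally Sidorenko: the radius may depend on `n`, `α` and `f`. -/
def IsWeaklyLocallySidorenko [NeZero p] (Ψ : LinFormSystem p t D) : Prop :=
  ∀ n : ℕ, 1 ≤ n → ∀ α ∈ Set.Icc (0 : ℝ) 1, ∀ f : (Fin n → ZMod p) → ℝ,
    (∀ x, f x ∈ Set.Icc (-α) (1 - α)) → 𝔼 x, f x = 0 →
      ∃ ε₀ : ℝ, 0 < ε₀ ∧ ∀ ε : ℝ, 0 < ε → ε < ε₀ →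
        α ^ t ≤ T Ψ n (fun x => α + ε * f x)

/-- The image of `Ψ : 𝔽_p^D → 𝔽_p^t` is the solution set of the two linear equations with
coefficient matrix `M`. -/
def IsDefinedBy (Ψ : LinFormSystem p t D) (M : Matrix (Fin 2) (Fin t) (ZMod p)) : Prop :=
  LinearMap.range (LinearMap.pi Ψ) = LinearMap.ker M.mulVecLin

/-- `Ψ` contains an additive `k`-tuple: some `k` of the forms, suitably ordered, form a system
whose image is described by the single equation `x₁ - x₂ + x₃ - ⋯ + (-1)^(k+1) x_k = 0`. -/
def ContainsAdditiveTuple (Ψ : LinFormSystem p t D) (k : ℕ) : Prop :=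
  ∃ e : Fin k ↪ Fin t, ∀ y : Fin k → ZMod p,
    y ∈ LinearMap.range (LinearMap.pi fun j => Ψ (e j)) ↔
      ∑ j : Fin k, (-1 : ZMod p) ^ (j : ℕ) * y j = 0

end LinFormSystem

/-- Every `2 × 2` minor of the `2 × t` matrix `M` is nonzero. -/
def IsLinearlyGeneric {p t : ℕ} (M : Matrix (Fin 2) (Fin t) (ZMod p)) : Prop :=
  ∀ i j : Fin t, i ≠ j → (M.submatrix id ![i, j]).det ≠ 0

/-! Expanding `1/2 + ε f` into characters turns the count into a sum over tuples of frequencies, one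
per form. For linear characters a tuple survives exactly when it lies in the row space of `M`, and
genericity says that a nonzero row vector has at most one zero entry. Density `1/2` suffices
throughout; each obstruction is an `f` that pushes the count below `(1/2)^t`.

Even `t` (`IsWeaklyLocallySidorenko.odd`): give every nonzero frequency the coefficient `-δ`. Row
vectors with one zero contribute `-δ^(t-1)/2`, which for small `δ` beats the at most `p^t` terms
`δ^t` of full support.

Additive tuple (`IsWeaklyLocallySidorenko.containsAdditiveTuple`): on `𝔽_p²` use the columns of `M`,
up to sign, as frequencies with a common phase in `ZMod (t + 1)`. At phase `0` all terms are
nonnegative and the rows of `M` give a strict excess. Averaged over the phase, only the trivial term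
remains unless there is an additive tuple (`IsDefinedBy.frequency_eq_none`), so some phase would
give a deficit.

For `t = 3` the additive pair makes two forms equal, and a difference of two point masses forces the
third to agree (`IsWeaklyLocallySidorenko.eq_of_three`).

For odd `t ≥ 5` (`IsLocallySidorenko.lt_four`) tensor the centred point mass with the zero set of a
hyperbolic quadratic form in `2m` variables. A term now also carries the `m`-th power of the density
of the kernel of a Gram form. Terms with one zero entry have kernel of dimension at most 1 above the
minimum, while some negative term of full support has at least 2; large `m` makes it dominate. Since
`m` depends on `ε`, this refutes only the uniform, local property. -/

namespace LinFormSystem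

/-! ### The multilinear form on linear and bilinear characters. -/

section Form

variable {p t D : ℕ} [Fact p.Prime]

/-- The multilinear form attached to `Ψ` over an arbitrary `𝔽_p`-module `G`, in which the form `ψ`
acts on `G^D` by `x ↦ ∑ d, ψ (e_d) • x_d`. -/
noncomputable def form (Ψ : LinFormSystem p t D) (G : Type) [AddCommGroup G] [Module (ZMod p) G]
    [Fintype G] (F : Fin t → G → ℂ) : ℂ :=
  𝔼 x : Fin D → G, ∏ i, F i (∑ d, Ψ i (Pi.single d 1) • x d)

lemma sum_single_smul (ψ : Module.Dual (ZMod p) (Fin D → ZMod p)) (x : Fin D → ZMod p) :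
    ∑ d, ψ (Pi.single d 1) • x d = ψ x := by
  conv_rhs => rw [← LinearMap.sum_single_apply (φ := fun _ => ZMod p) x, map_sum]
  refine Finset.sum_congr rfl fun d _ => ?_
  rw [show (Pi.single d (x d) : Fin D → ZMod p)
    = x d • Pi.single d 1 by rw [← Pi.single_smul]; simp, map_smul, smul_eq_mul, smul_eq_mul, mul_comm]

lemma stdAddChar_sum {ι : Type*} (s : Finset ι) (f : ι → ZMod p) :
    (ZMod.stdAddChar (∑ i ∈ s, f i) : ℂ) = ∏ i ∈ s, ZMod.stdAddChar (f i) := by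
  classical
  induction s using Finset.induction_on with
  | empty => simp
  | insert a s ha ih => rw [Finset.sum_insert ha, Finset.prod_insert ha, AddChar.map_add_eq_mul, ih]

lemma form_expand (Ψ : LinFormSystem p t D) {G : Type} [AddCommGroup G] [Module (ZMod p) G]
    [Fintype G] {J : Type} [Fintype J] (a : J → ℂ) (φ : J → G → ℂ) :
    Ψ.form G (fun _ v => ∑ j, a j * φ j v) =
      ∑ j : Fin t → J, (∏ i, a (j i)) * Ψ.form G (fun i => φ (j i)) := by
  classical
  simp only [form, Finset.mul_expect]
  rw [← Finset.expect_sum_comm]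
  refine Finset.expect_congr rfl fun x _ => ?_
  rw [Fintype.prod_sum]
  exact Finset.sum_congr rfl fun j _ => Finset.prod_mul_distrib

lemma form_prod (Ψ : LinFormSystem p t D) {G H : Type} [AddCommGroup G] [Module (ZMod p) G]
    [Fintype G] [AddCommGroup H] [Module (ZMod p) H] [Fintype H]
    (F : Fin t → G → ℂ) (F' : Fin t → H → ℂ) :
    Ψ.form (G × H) (fun i v => F i v.1 * F' i v.2) = Ψ.form G F * Ψ.form H F' := by
  simp only [form]
  rw [Fintype.expect_mul_expect, ← Finset.expect_product',
    Finset.univ_product_univ]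
  refine Fintype.expect_equiv (Equiv.arrowProdEquivProdArrow _ _ _) _ _ fun x => ?_
  simp [Finset.prod_mul_distrib, Prod.fst_sum, Prod.snd_sum, Equiv.arrowProdEquivProdArrow]

lemma form_pi (Ψ : LinFormSystem p t D) {κ G : Type} [Fintype κ] [DecidableEq κ] [AddCommGroup G]
    [Module (ZMod p) G] [Fintype G] (F : κ → Fin t → G → ℂ) :
    Ψ.form (κ → G) (fun i v => ∏ k, F k i (v k)) = ∏ k, Ψ.form G (F k) := by
  simp only [form, Fintype.expect_eq_sum_div_card, Finset.prod_div_distrib, Fintype.prod_sum]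
  congr 1
  · refine Fintype.sum_equiv (Equiv.piComm fun _ _ => G) _ _ fun x => ?_
    rw [Finset.prod_comm]
    simp [Finset.sum_apply]
  · simp only [Fintype.card_pi, Finset.prod_const, Finset.card_univ, Nat.cast_pow]
    rw [← pow_mul, ← pow_mul, mul_comm]

lemma expect_stdAddChar_dotProduct (L : Fin D → ZMod p) :
    (𝔼 x : Fin D → ZMod p, ZMod.stdAddChar (∑ d, x d * L d) : ℂ) = if L = 0 then 1 else 0 := by
  have hp : (p : ℂ) ≠ 0 := Nat.cast_ne_zero.2 (Fact.out : p.Prime).ne_zero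
  simp only [stdAddChar_sum, Fintype.expect_eq_sum_div_card]
  rw [← Fintype.prod_sum (fun d x => (ZMod.stdAddChar (x * L d) : ℂ))]
  simp only [AddChar.sum_mulShift _ (ZMod.isPrimitive_stdAddChar p), ZMod.card]
  split_ifs with h
  · subst h; simp [hp]
  · obtain ⟨d, hd⟩ := Function.ne_iff.1 h
    rw [Finset.prod_eq_zero (Finset.mem_univ d) (by rw [if_neg (by simpa using hd), Nat.cast_zero]), zero_div]

lemma sum_smul_eq_zero_iff (Ψ : LinFormSystem p t D) (c : Fin t → ZMod p) :
    (fun d => ∑ i, c i * Ψ i (Pi.single d 1)) = 0 ↔ ∑ i, c i • Ψ i = 0 := by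
  constructor
  · intro h
    refine LinearMap.pi_ext' fun d => LinearMap.ext_ring ?_
    simpa using congrFun h d
  · intro h
    ext d
    simpa using congrArg (fun f => f (Pi.single d 1)) h

open Classical in
lemma form_linear (Ψ : LinFormSystem p t D) (c : Fin t → ZMod p) :
    Ψ.form (ZMod p) (fun i s => ZMod.stdAddChar (c i * s)) = if ∑ i, c i • Ψ i = 0 then 1 else 0 := by
  rw [← if_congr (sum_smul_eq_zero_iff Ψ c) rfl rfl, ← expect_stdAddChar_dotProduct, form]
  refine Finset.expect_congr rfl fun x _ => ?_
  rw [← stdAddChar_sum]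
  congr 1
  simp only [Finset.mul_sum, smul_eq_mul]
  rw [Finset.sum_comm]
  exact Finset.sum_congr rfl fun d _ => Finset.sum_congr rfl fun i _ => by ring

-- For fixed `Y` the phase is linear in `X`, so averaging over `X` first leaves the indicator that
-- the linear form `∑ i, c i Ψ_i(Y) Ψ_i` vanishes.
open Classical in
lemma form_bilinear (Ψ : LinFormSystem p t D) (c : Fin t → ZMod p) :
    Ψ.form (ZMod p × ZMod p) (fun i s => ZMod.stdAddChar (c i * (s.1 * s.2))) =
      ((Finset.univ.filter fun Y : Fin D → ZMod p => ∑ i, (c i * Ψ i Y) • Ψ i = 0).card : ℂ)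
        / (p : ℂ) ^ D := by
  have h1 : Ψ.form (ZMod p × ZMod p) (fun i s => ZMod.stdAddChar (c i * (s.1 * s.2))) =
      𝔼 Y : Fin D → ZMod p, 𝔼 X : Fin D → ZMod p, ZMod.stdAddChar
        (∑ d, X d * ∑ i, (c i * Ψ i Y) * Ψ i (Pi.single d 1)) := by
    rw [Finset.expect_comm, ← Finset.expect_product', Finset.univ_product_univ]
    refine Fintype.expect_equiv (Equiv.arrowProdEquivProdArrow _ _ _) _ _ fun x => ?_
    rw [← stdAddChar_sum]
    congr 1
    simp only [Finset.mul_sum, Prod.fst_sum, Prod.snd_sum, Prod.smul_fst, Prod.smul_snd,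
      Equiv.arrowProdEquivProdArrow, Equiv.coe_fn_mk, sum_single_smul]
    rw [Finset.sum_comm]
    refine Finset.sum_congr rfl fun i _ => ?_
    rw [← sum_single_smul (Ψ i) fun d => (x d).1, Finset.sum_mul, Finset.mul_sum]
    exact Finset.sum_congr rfl fun d _ => by rw [smul_eq_mul]; ring
  rw [h1]
  simp only [expect_stdAddChar_dotProduct]
  rw [Fintype.expect_eq_sum_div_card]
  simp only [sum_smul_eq_zero_iff Ψ (fun i => c i * Ψ i _)]
  simp [Fintype.card_pi]

/-- Passing from `𝔽_p^n` to an isomorphic module. -/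
lemma form_transport (Ψ : LinFormSystem p t D) {n : ℕ} {G : Type} [AddCommGroup G]
    [Module (ZMod p) G] [Fintype G] (e : (Fin n → ZMod p) ≃ₗ[ZMod p] G) (g : G → ℝ) :
    (T Ψ n (fun x => g (e x)) : ℂ) = Ψ.form G (fun _ v => (g v : ℂ)) := by
  rw [T, form, ← Complex.ofRealHom_eq_coe]
  simp only [Fintype.expect_eq_sum_div_card, map_div₀, map_sum, map_prod, map_natCast]
  rw [Fintype.card_congr (Equiv.arrowCongr (Equiv.refl (Fin D)) e.toEquiv)]
  congr 1
  refine Fintype.sum_equiv (Equiv.arrowCongr (Equiv.refl (Fin D)) e.toEquiv) _ _ fun x => ?_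
  refine Finset.prod_congr rfl fun i _ => ?_
  have : e (induced (Ψ i) n x) = ∑ d, Ψ i (Pi.single d 1) • e (x d) := by
    simp only [← map_smul, ← map_sum]
    congr 1
    ext k
    rw [induced, ← sum_single_smul]
    simp
  rw [this]
  rfl

end Form
end LinFormSystem

namespace LinFormSystem

/-! ### Relations between the forms, and the Sidorenko properties over arbitrary finite modules. -/

section Transfer

variable {p t D : ℕ} [Fact p.Prime]

/-- Linear relations between the forms are the functionals killing the image `ker M`, and the
annihilator of a kernel is the range of the dual map, here the row space. -/
lemma IsDefinedBy.sum_smul_eq_zero_iff {Ψ : LinFormSystem p t D}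
    {M : Matrix (Fin 2) (Fin t) (ZMod p)} (h : Ψ.IsDefinedBy M) (c : Fin t → ZMod p) :
    ∑ i, c i • Ψ i = 0 ↔ ∃ a : Fin 2 → ZMod p, ∀ i, c i = ∑ r, a r * M r i := by
  constructor
  · intro hc
    let φ : Module.Dual (ZMod p) (Fin t → ZMod p) := ∑ i, c i • LinearMap.proj i
    have hφ : φ ∈ LinearMap.range M.mulVecLin.dualMap := by
      rw [LinearMap.range_dualMap_eq_dualAnnihilator_ker, Submodule.mem_dualAnnihilator]
      intro w hw
      rw [← h] at hw
      obtain ⟨x, rfl⟩ := hw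
      simpa [φ] using congrArg (fun f => f x) hc
    obtain ⟨a, ha⟩ := hφ
    refine ⟨fun r => a (Pi.single r 1), fun i => ?_⟩
    have := congrArg (fun f => f (Pi.single i 1)) ha
    simp only [LinearMap.dualMap_apply, Matrix.mulVecLin_apply, Matrix.mulVec_single_one, φ,
      LinearMap.sum_apply, LinearMap.smul_apply, LinearMap.proj_apply, Pi.single_apply,
      smul_eq_mul, mul_ite, mul_one, mul_zero, Finset.sum_ite_eq', Finset.mem_univ, if_true] at this
    rw [← this, ← sum_single_smul a]
    rfl
  · rintro ⟨a, ha⟩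
    ext d
    have hx : LinearMap.pi Ψ (Pi.single d 1) ∈ LinearMap.ker M.mulVecLin := h ▸ ⟨_, rfl⟩
    rw [LinearMap.mem_ker, Matrix.mulVecLin_apply] at hx
    simp only [LinearMap.coe_comp, Function.comp_apply, LinearMap.sum_apply, LinearMap.smul_apply,
      smul_eq_mul, LinearMap.zero_apply, LinearMap.single_apply, ha, Finset.sum_mul]
    rw [Finset.sum_comm]
    refine Finset.sum_eq_zero fun r _ => ?_
    have := congrFun hx r
    simp only [Matrix.mulVec, dotProduct, LinearMap.pi_apply, Pi.zero_apply] at this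
    simp only [mul_assoc, ← Finset.mul_sum, this, mul_zero]

lemma IsSidorenko.isLocallySidorenko {Ψ : LinFormSystem p t D} (h : Ψ.IsSidorenko) :
    Ψ.IsLocallySidorenko := by
  intro α _
  refine ⟨1, one_pos, fun n hn f hf hf0 => ?_⟩
  have := h n hn (fun x => α + 1 * f x) fun x => by
    have := hf x
    exact ⟨by linarith [this.1], by linarith [this.2]⟩
  simpa [Finset.expect_add_distrib, hf0] using this

/-- The interval `[-α, 1 - α]` is convex and contains `0`, so a smaller radius is the uniform radius
applied to a shrunken function. -/
lemma IsLocallySidorenko.isWeaklyLocallySidorenko {Ψ : LinFormSystem p t D}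
    (h : Ψ.IsLocallySidorenko) : Ψ.IsWeaklyLocallySidorenko := by
  intro n hn α hα f hf hf0
  obtain ⟨ε, hε, H⟩ := h α hα
  refine ⟨ε, hε, fun δ hδ hδε => ?_⟩
  have h0 : 0 < δ / ε := div_pos hδ hε
  have h1 : δ / ε ≤ 1 := ((div_lt_one hε).2 hδε).le
  have := H n hn (fun x => δ / ε * f x) (fun x => ?_) (by
    rw [← Finset.mul_expect, hf0, mul_zero])
  · simpa only [← mul_assoc, mul_div_cancel₀ δ hε.ne'] using this
  · obtain ⟨h2, h3⟩ := hf x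
    obtain ⟨h4, h5⟩ := hα
    constructor
    · nlinarith [mul_nonneg h0.le (by linarith : 0 ≤ f x + α), mul_nonneg (sub_nonneg.2 h1) h4]
    · nlinarith [mul_nonneg h0.le (by linarith : 0 ≤ 1 - α - f x),
        mul_nonneg (sub_nonneg.2 h1) (sub_nonneg.2 h5)]

section Module

variable {G : Type} [AddCommGroup G] [Module (ZMod p) G] [Fintype G]

lemma exists_linearEquiv_pi (p : ℕ) [Fact p.Prime] (G : Type) [AddCommGroup G] [Module (ZMod p) G]
    [Fintype G] [Nontrivial G] : ∃ n, 1 ≤ n ∧ Nonempty ((Fin n → ZMod p) ≃ₗ[ZMod p] G) :=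
  have : Module.Finite (ZMod p) G := Module.Finite.of_finite
  ⟨Module.finrank (ZMod p) G, Module.finrank_pos,
    ⟨(Module.finBasis (ZMod p) G).equivFun.symm⟩⟩

lemma expect_comp_linearEquiv {n : ℕ} (e : (Fin n → ZMod p) ≃ₗ[ZMod p] G) {f : G → ℝ}
    (hf : ∑ v, f v = 0) : 𝔼 x, f (e x) = 0 := by
  rw [Fintype.expect_equiv e.toEquiv (fun x => f (e x)) f fun _ => rfl,
    Fintype.expect_eq_sum_div_card, hf, zero_div]

/-- Weak local Sidorenko at density `1/2`, over an arbitrary finite module. -/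
lemma IsWeaklyLocallySidorenko.le_form [Nontrivial G] {Ψ : LinFormSystem p t D} (h : Ψ.IsWeaklyLocallySidorenko)
    (f : G → ℝ) (hf : ∀ v, |f v| ≤ 1 / 2) (hf0 : ∑ v, f v = 0) :
    ∀ᶠ ε : ℝ in nhdsWithin 0 (Set.Ioi 0),
      (1 / 2) ^ t ≤ (Ψ.form G (fun _ v => 1 / 2 + (ε : ℂ) * (f v : ℂ))).re := by
  obtain ⟨n, hn, ⟨e⟩⟩ := exists_linearEquiv_pi p G
  obtain ⟨ε₀, hε₀, H⟩ := h n hn (1 / 2) (by norm_num) (fun x => f (e x))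
    (fun x => by have := abs_le.1 (hf (e x)); constructor <;> linarith [this.1, this.2])
    (expect_comp_linearEquiv e hf0)
  filter_upwards [Ioo_mem_nhdsGT hε₀] with ε hε
  refine (H ε hε.1 hε.2).trans_eq ?_
  simpa using congrArg Complex.re (form_transport Ψ e (fun v => 1 / 2 + ε * f v))

/-- Local Sidorenko at density `1/2`, over arbitrary finite modules. -/
lemma IsLocallySidorenko.le_form {Ψ : LinFormSystem p t D} (h : Ψ.IsLocallySidorenko) :
    ∃ ε : ℝ, 0 < ε ∧ ∀ (G : Type) [AddCommGroup G] [Module (ZMod p) G] [Fintype G] [Nontrivial G]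
      (f : G → ℝ), (∀ v, |f v| ≤ 1 / 2) → ∑ v, f v = 0 →
      (1 / 2) ^ t ≤ (Ψ.form G (fun _ v => 1 / 2 + (ε : ℂ) * (f v : ℂ))).re := by
  obtain ⟨ε, hε, H⟩ := h (1 / 2) (by norm_num)
  refine ⟨ε, hε, ?_⟩
  intro G _ _ _ _ f hf hf0
  obtain ⟨n, hn, ⟨e⟩⟩ := exists_linearEquiv_pi p G
  refine (H n hn (fun x => f (e x)) (fun x => ?_) (expect_comp_linearEquiv e hf0)).trans_eq ?_
  · have := abs_le.1 (hf (e x)); constructor <;> linarith [this.1, this.2]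
  · simpa using congrArg Complex.re (form_transport Ψ e (fun v => 1 / 2 + ε * f v))

end Module

end Transfer
end LinFormSystem

/-! ### Row combinations of a linearly generic matrix. -/

section Generic

variable {p t : ℕ} {M : Matrix (Fin 2) (Fin t) (ZMod p)}

lemma IsLinearlyGeneric.minor_ne_zero (h : IsLinearlyGeneric M) {i j : Fin t} (hij : i ≠ j) :
    M 0 i * M 1 j - M 0 j * M 1 i ≠ 0 := by
  have := h i j hij
  rw [Matrix.det_fin_two] at this
  simpa [mul_comm] using this

lemma IsLinearlyGeneric.eq_of_minor_eq_zero (h : IsLinearlyGeneric M) {i j : Fin t}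
    (hij : M 0 i * M 1 j - M 0 j * M 1 i = 0) : i = j :=
  not_not.1 fun hne => h.minor_ne_zero hne hij

variable [Fact p.Prime]

lemma IsLinearlyGeneric.eq_zero_of_two_zeros (h : IsLinearlyGeneric M) {a : Fin 2 → ZMod p}
    {i j : Fin t} (hij : i ≠ j) (hi : ∑ r, a r * M r i = 0) (hj : ∑ r, a r * M r j = 0) :
    a = 0 := by
  rw [Fin.sum_univ_two] at hi hj
  have hd := h.minor_ne_zero hij
  have h0 : a 0 = 0 := (mul_eq_zero.1 (show a 0 * (M 0 i * M 1 j - M 0 j * M 1 i) = 0 by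
    linear_combination M 1 j * hi - M 1 i * hj)).resolve_right hd
  have h1 : a 1 = 0 := (mul_eq_zero.1 (show a 1 * (M 0 i * M 1 j - M 0 j * M 1 i) = 0 by
    linear_combination M 0 i * hj - M 0 j * hi)).resolve_right hd
  ext r
  fin_cases r <;> simp [h0, h1]

lemma two_le_of_rank_eq_two (h : M.rank = 2) : 2 ≤ t := by
  simpa [h] using M.rank_le_width

lemma IsLinearlyGeneric.col_ne_zero (h : IsLinearlyGeneric M) (ht : 2 ≤ t) (i : Fin t) :
    ∃ r, M r i ≠ 0 := by
  have : Nontrivial (Fin t) := Fin.nontrivial_iff_two_le.2 ht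
  obtain ⟨j, hj⟩ := exists_ne i
  by_contra! h0
  exact h.minor_ne_zero hj.symm (by rw [h0 0, h0 1]; ring)

/-- The row combination which eliminates the variable `i`. -/
def eliminate (M : Matrix (Fin 2) (Fin t) (ZMod p)) (i : Fin t) : Fin 2 → ZMod p :=
  ![-M 1 i, M 0 i]

lemma sum_eliminate_mul (i j : Fin t) :
    ∑ r, eliminate M i r * M r j = M 0 i * M 1 j - M 0 j * M 1 i := by
  simp [eliminate, Fin.sum_univ_two]; ring

end Generic

section Product

lemma prod_eq_mul_pow_of_ne {R : Type*} [CommSemiring R] {t : ℕ} (b : Fin t → R) (i : Fin t)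
    {x y : R} (hi : b i = x) (h : ∀ j, j ≠ i → b j = y) : ∏ j, b j = x * y ^ (t - 1) := by
  rw [← Finset.mul_prod_erase _ _ (Finset.mem_univ i), hi, Finset.prod_congr rfl
    (g := fun _ => y) (fun j hj => h j (Finset.ne_of_mem_erase hj))]
  simp

end Product

/-! ### Parity: an even number of forms is impossible. -/

namespace LinFormSystem

variable {p t D : ℕ} [Fact p.Prime]

lemma sum_stdAddChar_mul (s : ZMod p) :
    (∑ c : ZMod p, ZMod.stdAddChar (c * s) : ℂ) = if s = 0 then (p : ℂ) else 0 := by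
  rw [AddChar.sum_mulShift s (ZMod.isPrimitive_stdAddChar p), ZMod.card]
  split_ifs <;> simp

/-- A nonzero row combination with two vanishing entries does not exist. -/
lemma IsDefinedBy.unique_zero {Ψ : LinFormSystem p t D} {M : Matrix (Fin 2) (Fin t) (ZMod p)}
    (hΨ : Ψ.IsDefinedBy M) (hM : IsLinearlyGeneric M) {c : Fin t → ZMod p} (hc : c ≠ 0)
    (hc0 : ∑ i, c i • Ψ i = 0) {i j : Fin t} (hi : c i = 0) (hj : c j = 0) : j = i := by
  obtain ⟨a, ha⟩ := (hΨ.sum_smul_eq_zero_iff c).1 hc0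
  by_contra hij
  refine hc (funext fun l => ?_)
  have ha0 : a = 0 :=
    hM.eq_zero_of_two_zeros hij ((ha j).symm.trans hj) ((ha i).symm.trans hi)
  simpa [ha0] using ha l

/-- The mean-zero function with value `p - 1` at the origin and `-1` elsewhere. -/
noncomputable def centredDelta (p : ℕ) [Fact p.Prime] (s : ZMod p) : ℝ :=
  (if s = 0 then (p : ℝ) else 0) - 1

lemma sum_centredDelta : ∑ s, centredDelta p s = 0 := by
  simp [centredDelta, Finset.sum_sub_distrib]

lemma abs_centredDelta_le (s : ZMod p) : |centredDelta p s| ≤ p := by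
  have : (1 : ℝ) ≤ p := by exact_mod_cast (Fact.out : p.Prime).one_lt.le
  rw [centredDelta, abs_le]
  split_ifs <;> constructor <;> linarith

lemma sum_ite_stdAddChar (s : ZMod p) :
    (∑ c : ZMod p, (if c = 0 then 0 else 1) * ZMod.stdAddChar (c * s) : ℂ) = centredDelta p s := by
  have h := sum_stdAddChar_mul s
  rw [Fintype.sum_eq_add_sum_compl 0] at h ⊢
  rw [Finset.sum_congr rfl (g := fun c => (ZMod.stdAddChar (c * s) : ℂ)) fun c hc => by
    rw [if_neg (by simpa using hc), one_mul]]
  rw [zero_mul, AddChar.map_zero_eq_one] at h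
  simp only [centredDelta, if_true, zero_mul, zero_add]
  rw [eq_sub_of_add_eq' h]
  push_cast
  split_ifs <;> simp

lemma IsWeaklyLocallySidorenko.odd {Ψ : LinFormSystem p t D} (h : Ψ.IsWeaklyLocallySidorenko)
    {M : Matrix (Fin 2) (Fin t) (ZMod p)} (ht : 2 ≤ t) (hΨ : Ψ.IsDefinedBy M)
    (hM : IsLinearlyGeneric M) : Odd t := by
  classical
  by_contra heven
  rw [Nat.not_odd_iff_even] at heven
  have hp : (1 : ℝ) ≤ p := by exact_mod_cast (Fact.out : p.Prime).one_lt.le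
  have hp0 : (0 : ℝ) < p := by linarith
  have hle := h.le_form (G := ZMod p) (fun s => -(centredDelta p s / (2 * p))) (fun s => by
    rw [abs_neg, abs_div, abs_of_pos (by linarith : (0 : ℝ) < 2 * p),
      div_le_div_iff₀ (by linarith) two_pos]
    linarith [abs_centredDelta_le s]) (by
    rw [Finset.sum_neg_distrib, ← Finset.sum_div, sum_centredDelta, zero_div, neg_zero])
  -- The bound `ε < p^(-t)` lets one term of order `δ^(t-1)` outweigh up to `p^t` terms `δ^t`.
  obtain ⟨ε, hε, hε0, hε1⟩ := (hle.and (Ioo_mem_nhdsGT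
    (inv_pos.2 (pow_pos hp0 t)))).exists
  set δ : ℝ := ε / (2 * p) with hδ
  have hδ0 : 0 < δ := by positivity
  have hδ1 : p ^ t * δ < 1 / 2 := by
    rw [lt_inv_comm₀ hε0 (by positivity), ← one_div, lt_div_iff₀ hε0] at hε1
    rw [hδ, ← mul_div_assoc, div_lt_div_iff₀ (by positivity) two_pos]
    nlinarith
  let b : ZMod p → ℝ := fun c => if c = 0 then 1 / 2 else -δ
  have hb : ∀ c, c ≠ 0 → b c = -δ := fun c hc => if_neg hc
  have hb0 : b 0 = 1 / 2 := if_pos rfl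
  let B : (Fin t → ZMod p) → ℝ := fun c => (∏ i, b (c i)) * if ∑ i, c i • Ψ i = 0 then 1 else 0
  have hform : Ψ.form (ZMod p) (fun _ v => 1 / 2 + (ε : ℂ) *
      ((-(centredDelta p v / (2 * p)) : ℝ) : ℂ)) = ((∑ c, B c : ℝ) : ℂ) := by
    have h1 : ∀ v : ZMod p, 1 / 2 + (ε : ℂ) * ((-(centredDelta p v / (2 * p)) : ℝ) : ℂ) =
        ∑ c : ZMod p, (b c : ℂ) * ZMod.stdAddChar (c * v) := by
      intro v
      have h2 : ∀ c : ZMod p, (b c : ℂ) * ZMod.stdAddChar (c * v) =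
          (if c = 0 then 1 / 2 else 0) - δ * ((if c = 0 then 0 else 1) *
            ZMod.stdAddChar (c * v)) := by
        intro c
        by_cases hc : c = 0
        · simp [b, hc]
        · simp [b, hc]
      simp only [h2, Finset.sum_sub_distrib, ← Finset.mul_sum, sum_ite_stdAddChar,
        Finset.sum_ite_eq', Finset.mem_univ, if_true, hδ]
      push_cast
      ring
    simp only [h1]
    rw [form_expand]
    simp only [form_linear, B]
    push_cast
    exact Finset.sum_congr rfl fun c _ => by split_ifs <;> simp
  rw [hform, Complex.ofReal_re] at hε
  let i₀ : Fin t := ⟨0, by omega⟩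
  -- Eliminating `i₀` gives a row vector vanishing at `i₀` alone; this one negative term is enough.
  let c₀ : Fin t → ZMod p := fun i => M 0 i₀ * M 1 i - M 0 i * M 1 i₀
  have hc₀ : ∑ i, c₀ i • Ψ i = 0 := (hΨ.sum_smul_eq_zero_iff c₀).2
    ⟨eliminate M i₀, fun i => (sum_eliminate_mul i₀ i).symm⟩
  have hodd : (-δ) ^ (t - 1) = -δ ^ (t - 1) :=
    Odd.neg_pow (by obtain ⟨k, hk⟩ := heven; exact ⟨k - 1, by omega⟩) _
  have hone : ∀ (c : Fin t → ZMod p) (i : Fin t), c i = 0 → (∀ j, j ≠ i → c j ≠ 0) →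
      ∏ i, b (c i) = -(1 / 2 * δ ^ (t - 1)) := fun c i hi hj => by
    rw [prod_eq_mul_pow_of_ne (fun i => b (c i)) i (by rw [hi, hb0]) fun j hj' => hb _ (hj j hj'),
      hodd, mul_neg]
  have hB : ∀ c, B c ≤ δ ^ t + (if c = 0 then (1 / 2) ^ t else 0)
      + (if c = c₀ then -(1 / 2 * δ ^ (t - 1)) else 0) := by
    intro c
    have hc₀0 : c₀ ≠ 0 := by
      have : Nontrivial (Fin t) := Fin.nontrivial_iff_two_le.2 ht
      obtain ⟨j, hj⟩ := exists_ne i₀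
      exact fun h => hM.minor_ne_zero hj.symm (congrFun h j)
    by_cases h0 : c = 0
    · rw [if_pos h0, if_neg (h0 ▸ hc₀0.symm)]
      simp only [B, h0, Pi.zero_apply, hb0, Finset.prod_const, Finset.card_univ, Fintype.card_fin,
        zero_smul, Finset.sum_const_zero, if_true, mul_one, add_zero]
      linarith [pow_pos hδ0 t]
    by_cases h1 : c = c₀
    · have : B c = -(1 / 2 * δ ^ (t - 1)) := by
        simp only [B]
        rw [if_pos (h1 ▸ hc₀), mul_one]
        exact hone c i₀ (by rw [h1]; simp [c₀, mul_comm]) fun j hj => by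
          rw [h1]; exact hM.minor_ne_zero hj.symm
      rw [if_neg h0, if_pos h1, this]
      linarith [pow_pos hδ0 t]
    rw [if_neg h0, if_neg h1, add_zero, add_zero]
    by_cases h2 : ∑ i, c i • Ψ i = 0
    · simp only [B]
      rw [if_pos h2, mul_one]
      by_cases h3 : ∃ i, c i = 0
      · obtain ⟨i, hi⟩ := h3
        rw [hone c i hi fun j hj hcj => hj (hΨ.unique_zero hM h0 h2 hi hcj)]
        linarith [pow_pos hδ0 t, pow_pos hδ0 (t - 1)]
      · push Not at h3
        rw [Finset.prod_congr rfl fun i _ => hb _ (h3 i)]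
        simp [heven.neg_pow]
    · simp only [B]
      rw [if_neg h2, mul_zero]
      positivity
  have hsum := Finset.sum_le_sum fun c (_ : c ∈ Finset.univ) => hB c
  simp only [Finset.sum_add_distrib, Finset.sum_const, Finset.card_univ, Fintype.card_pi,
    ZMod.card, Finset.prod_const, Fintype.card_fin, nsmul_eq_mul, Finset.sum_ite_eq',
    Finset.mem_univ, if_true, Nat.cast_pow] at hsum
  have hpow : δ ^ t = δ ^ (t - 1) * δ := by rw [← pow_succ]; congr 1; omega
  rw [hpow] at hsum
  nlinarith [pow_pos hδ0 (t - 1), mul_lt_mul_of_pos_left hδ1 (pow_pos hδ0 (t - 1))]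

end LinFormSystem

/-! ### From a relation with balanced signs to an additive tuple. -/

section Signs

lemma two_mul_card_fiber_of_sum_eq_zero {α : Type*} [Fintype α] (s : α → ℤˣ)
    (hs : ∑ a, (s a : ℤ) = 0) (u : ℤˣ) : 2 * Fintype.card {a // s a = u} = Fintype.card α := by
  classical
  have h : ∀ a, (u : ℤ) * s a = 2 * (if s a = u then 1 else 0) - 1 := by
    intro a
    rcases Int.units_eq_one_or u with rfl | rfl <;> rcases Int.units_eq_one_or (s a) with h | h <;>
      rw [h] <;> decide
  have : ∑ a, (u : ℤ) * s a = 0 := by rw [← Finset.mul_sum, hs, mul_zero]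
  rw [Finset.sum_congr rfl fun a _ => h a, Finset.sum_sub_distrib, ← Finset.mul_sum,
    Finset.sum_boole] at this
  rw [Fintype.card_subtype]
  simp at this
  omega

/-- Both sign patterns take each value on exactly half of the points, so their fibres can be
matched. -/
lemma exists_equiv_alternating {α : Type*} [Fintype α] {k : ℕ} (s : α → ℤˣ)
    (hs : ∑ a, (s a : ℤ) = 0) (hk : Fintype.card α = k) :
    ∃ e : Fin k ≃ α, ∀ j, s (e j) = (-1) ^ (j : ℕ) := by
  classical
  have hkeven : Even k := by
    rw [← hk, ← two_mul_card_fiber_of_sum_eq_zero s hs 1]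
    exact even_two_mul _
  have hg : ∑ j : Fin k, (((-1 : ℤˣ) ^ (j : ℕ) : ℤˣ) : ℤ) = 0 := by
    push_cast
    rw [Fin.sum_univ_eq_sum_range (fun j => (-1 : ℤ) ^ j), neg_one_geom_sum, if_pos hkeven]
  refine ⟨Equiv.ofFiberEquiv (f := fun j : Fin k => (-1 : ℤˣ) ^ (j : ℕ)) (g := s)
    fun u => Fintype.equivOfCardEq ?_, fun j => Equiv.ofFiberEquiv_map _ j⟩
  have h1 := two_mul_card_fiber_of_sum_eq_zero s hs u
  have h2 := two_mul_card_fiber_of_sum_eq_zero _ hg u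
  rw [hk] at h1
  rw [Fintype.card_fin] at h2
  omega

end Signs

namespace LinFormSystem

variable {p t D : ℕ} [Fact p.Prime]

lemma IsDefinedBy.containsAdditiveTuple {Ψ : LinFormSystem p t D}
    {M : Matrix (Fin 2) (Fin t) (ZMod p)} (hΨ : Ψ.IsDefinedBy M) {k : ℕ}
    (E : Option (Fin k) ≃ Fin t) (a : Fin 2 → ZMod p) (hcol : ∃ r, M r (E none) ≠ 0)
    (ha : a ≠ 0) (h0 : ∑ r, a r * M r (E none) = 0)
    (h1 : ∀ j, ∑ r, a r * M r (E (some j)) = (-1) ^ (j : ℕ)) : Ψ.ContainsAdditiveTuple k := by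
  classical
  refine ⟨Function.Embedding.some.trans E.toEmbedding, fun y => ⟨?_, fun hy => ?_⟩⟩
  · rintro ⟨x, rfl⟩
    have := (hΨ.sum_smul_eq_zero_iff fun i => ∑ r, a r * M r i).2 ⟨a, fun _ => rfl⟩
    rw [← Equiv.sum_comp E, Fintype.sum_option] at this
    simp only [h0, h1, zero_smul, zero_add] at this
    simpa using congrArg (fun f => f x) this
  · by_contra hy'
    -- Were the image smaller than the hyperplane, a functional would separate `y` from it. Extended
    -- by `0` at the omitted index it is a row vector, hence a multiple of the one given by `a`,
    -- which kills `y`.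
    obtain ⟨φ, hφy, hφ⟩ := Submodule.exists_le_ker_of_notMem hy'
    let c' : Fin k → ZMod p := fun j => φ (Pi.single j 1)
    have hc' : ∀ z, φ z = ∑ j, c' j * z j := fun z => (sum_single_smul φ z).symm
    let c : Fin t → ZMod p := fun i => (E.symm i).elim 0 c'
    have hc : ∑ i, c i • Ψ i = 0 := by
      rw [← Equiv.sum_comp E, Fintype.sum_option]
      ext d
      simpa [c, hc'] using hφ ⟨Pi.single d 1, rfl⟩
    obtain ⟨b, hb⟩ := (hΨ.sum_smul_eq_zero_iff c).1 hc
    have hbn : ∑ r, b r * M r (E none) = 0 := by rw [← hb]; simp [c]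
    have hbs : ∀ j, c' j = ∑ r, b r * M r (E (some j)) := fun j => by rw [← hb]; simp [c]
    -- Both `a` and `b` are orthogonal to the same nonzero column in a plane, hence proportional.
    have hab : b 0 * a 1 = b 1 * a 0 := by
      rw [Fin.sum_univ_two] at h0 hbn
      rcases Fin.exists_fin_two.1 hcol with hr | hr
      · exact mul_right_cancel₀ hr (by linear_combination a 1 * hbn - b 1 * h0)
      · exact mul_right_cancel₀ hr (by linear_combination b 0 * h0 - a 0 * hbn)
    obtain ⟨ν, hν⟩ : ∃ ν, ∀ r, b r = ν * a r := by
      by_cases ha0 : a 0 = 0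
      · have ha1 : a 1 ≠ 0 := fun h => ha (by ext r; fin_cases r <;> simp [ha0, h])
        refine ⟨b 1 / a 1, Fin.forall_fin_two.2 ⟨?_, ?_⟩⟩ <;> field_simp
        exact hab
      · refine ⟨b 0 / a 0, Fin.forall_fin_two.2 ⟨?_, ?_⟩⟩ <;> field_simp
        exact hab.symm
    apply hφy
    rw [hc']
    have : ∀ j, c' j = ν * (-1) ^ (j : ℕ) := fun j => by
      rw [hbs, ← h1, Finset.mul_sum]
      exact Finset.sum_congr rfl fun r _ => by rw [hν, mul_assoc]
    simp only [this, mul_assoc, ← Finset.mul_sum, hy, mul_zero]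

lemma IsDefinedBy.containsAdditiveTuple_of_signs {Ψ : LinFormSystem p t D}
    {M : Matrix (Fin 2) (Fin t) (ZMod p)} (hΨ : Ψ.IsDefinedBy M) (i : Fin t)
    (hcol : ∃ r, M r i ≠ 0) (a : Fin 2 → ZMod p) (ha : a ≠ 0) (h0 : ∑ r, a r * M r i = 0)
    (s : {l // l ≠ i} → ℤˣ) (hs : ∑ l, (s l : ℤ) = 0)
    (h1 : ∀ l : {l // l ≠ i}, ∑ r, a r * M r l = ((s l : ℤ) : ZMod p)) :
    Ψ.ContainsAdditiveTuple (t - 1) := by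
  classical
  obtain ⟨e, he⟩ := exists_equiv_alternating (k := t - 1) s hs (by
    rw [Fintype.card_subtype_compl]; simp)
  let E : Option (Fin (t - 1)) ≃ Fin t := (Equiv.optionCongr e).trans (Equiv.optionSubtypeNe i)
  have hn : E none = i := by simp [E]
  have hS : ∀ j, E (some j) = e j := fun j => by simp [E]
  refine hΨ.containsAdditiveTuple E a (by rwa [hn]) ha (by rwa [hn]) fun j => ?_
  rw [hS, h1, he]
  push_cast
  rfl

end LinFormSystem

/-! ### Which frequency choices survive averaging over the phase. -/

namespace LinFormSystem

variable {p t D : ℕ} [Fact p.Prime]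

/-- The frequencies used by the random function: the columns of `M` with signs, and zero. -/
def frequency (M : Matrix (Fin 2) (Fin t) (ZMod p)) : Option (Fin t × ℤˣ) → Fin 2 → ZMod p
  | none, _ => 0
  | some (k, s), r => ((s : ℤ) : ZMod p) * M r k

/-- The exponent with which the random phase enters the coefficient of a frequency. -/
def phase : Option (Fin t × ℤˣ) → ℤ
  | none => 0
  | some (_, s) => s

lemma intCast_unit_ne_zero (s : ℤˣ) : ((s : ℤ) : ZMod p) ≠ 0 := by
  rcases Int.units_eq_one_or s with rfl | rfl <;> simp

lemma exists_frequency_ne_zero {M : Matrix (Fin 2) (Fin t) (ZMod p)} (hM : IsLinearlyGeneric M)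
    (ht : 2 ≤ t) (q : Fin t × ℤˣ) : ∃ r, frequency M (some q) r ≠ 0 := by
  obtain ⟨r, hr⟩ := hM.col_ne_zero ht q.1
  exact ⟨r, mul_ne_zero (intCast_unit_ne_zero _) hr⟩

lemma exists_sum_units_eq {ι : Type*} (S : Finset ι) (s : ι → ℤˣ) :
    ∃ z : ℤ, ∑ i ∈ S, (s i : ℤ) = S.card - 2 * z := by
  classical
  induction S using Finset.induction_on with
  | empty => exact ⟨0, by simp⟩
  | insert a S ha ih =>
    obtain ⟨z, hz⟩ := ih
    rw [Finset.sum_insert ha, hz, Finset.card_insert_of_notMem ha]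
    rcases Int.units_eq_one_or (s a) with h | h <;> rw [h]
    · exact ⟨z, by push_cast; ring⟩
    · exact ⟨z + 1, by push_cast; ring⟩

lemma abs_sum_units_le {ι : Type*} (S : Finset ι) (s : ι → ℤˣ) :
    |∑ i ∈ S, (s i : ℤ)| ≤ S.card :=
  (Finset.abs_sum_le_sum_abs _ _).trans (by simp [Int.isUnit_iff_abs_eq.1])

/-- Without an additive tuple, no nontrivial choice of frequencies both contributes to the count
and survives averaging over the phase. -/
lemma IsDefinedBy.frequency_eq_none {Ψ : LinFormSystem p t D}
    {M : Matrix (Fin 2) (Fin t) (ZMod p)} (hΨ : Ψ.IsDefinedBy M) (hM : IsLinearlyGeneric M)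
    (ht : 2 ≤ t) (hodd : Odd t) (hno : ¬ Ψ.ContainsAdditiveTuple (t - 1))
    (j : Fin t → Option (Fin t × ℤˣ)) (hj : ∀ r, ∑ i, frequency M (j i) r • Ψ i = 0)
    (hN : ((t + 1 : ℕ) : ℤ) ∣ ∑ i, phase (j i)) (i : Fin t) : j i = none := by
  by_contra hi
  obtain ⟨q, hq⟩ := Option.ne_none_iff_exists'.1 hi
  obtain ⟨r₀, hr₀⟩ := exists_frequency_ne_zero hM ht q
  rw [← hq] at hr₀
  by_cases hnone : ∃ l, j l = none
  · obtain ⟨l, hl⟩ := hnone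
    -- A second `none` would give the nonzero row vector in coordinate `r₀` two zeros.
    have hsome : ∀ l' : {l' // l' ≠ l}, ∃ q, j l' = some q := by
      intro l'
      refine Option.ne_none_iff_exists'.1 fun h => l'.2 ?_
      exact hΨ.unique_zero hM (c := fun i => frequency M (j i) r₀) (fun h => hr₀ (congrFun h i))
        (hj r₀) (by rw [hl]; rfl) (by rw [h]; rfl)
    choose w hw using hsome
    have hli : i ≠ l := fun h => hi (h ▸ hl)
    choose A hA using fun r => (hΨ.sum_smul_eq_zero_iff _).1 (hj r)
    have hA0 : ∀ r, ∑ x, A r x * M x l = 0 := fun r => by rw [← hA, hl]; rfl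
    have hAw : ∀ r (l' : {l' // l' ≠ l}),
        (((w l').2 : ℤ) : ZMod p) * M r (w l').1 = ∑ x, A r x * M x l' := fun r l' => by
      rw [← hA, hw]; rfl
    -- The matrix `A` kills the nonzero column `l`, so it is singular and all chosen frequencies are
    -- parallel. By genericity they then come from a single column, up to sign.
    have hdet : A 0 0 * A 1 1 = A 0 1 * A 1 0 := by
      have h0 := hA0 0
      have h1 := hA0 1
      rw [Fin.sum_univ_two] at h0 h1
      rcases Fin.exists_fin_two.1 (hM.col_ne_zero ht l) with hr | hr
      · exact mul_right_cancel₀ hr (by linear_combination A 1 1 * h0 - A 0 1 * h1)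
      · exact mul_right_cancel₀ hr (by linear_combination A 0 0 * h1 - A 1 0 * h0)
    have hk : ∀ l', (w l').1 = (w ⟨i, hli⟩).1 := by
      intro l'
      refine hM.eq_of_minor_eq_zero ?_
      refine (mul_eq_zero.1 (?_ : ((((w l').2 : ℤ) : ZMod p) * (((w ⟨i, hli⟩).2 : ℤ) : ZMod p)) * _
        = 0)).resolve_left (mul_ne_zero (intCast_unit_ne_zero _) (intCast_unit_ne_zero _))
      have e1 := hAw 0 l'
      have e2 := hAw 1 l'
      have e3 := hAw 0 ⟨i, hli⟩
      have e4 := hAw 1 ⟨i, hli⟩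
      rw [Fin.sum_univ_two] at e1 e2 e3 e4
      trans ((((w l').2 : ℤ) : ZMod p) * M 0 (w l').1) *
          ((((w ⟨i, hli⟩).2 : ℤ) : ZMod p) * M 1 (w ⟨i, hli⟩).1) -
        ((((w ⟨i, hli⟩).2 : ℤ) : ZMod p) * M 0 (w ⟨i, hli⟩).1) *
          ((((w l').2 : ℤ) : ZMod p) * M 1 (w l').1)
      · ring
      · rw [e1, e2, e3, e4]
        linear_combination (M 0 l' * M 1 i - M 1 l' * M 0 i) * hdet
    have hsum : ∑ i, phase (j i) = ∑ l', ((w l').2 : ℤ) := by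
      rw [← Equiv.sum_comp (Equiv.optionSubtypeNe l), Fintype.sum_option]
      simp [hl, hw, phase]
    have hcard : (Finset.univ : Finset {l' // l' ≠ l}).card = t - 1 := by
      rw [Finset.card_univ, Fintype.card_subtype_compl]; simp
    have hzero : ∑ l', ((w l').2 : ℤ) = 0 := by
      rw [hsum] at hN
      refine Int.eq_zero_of_abs_lt_dvd hN ((abs_sum_units_le _ _).trans_lt ?_)
      rw [hcard]
      exact_mod_cast (by omega : t - 1 < t + 1)
    -- Dividing by the common entry `M r₀ k` leaves only the signs, which sum to zero.
    refine hno (hΨ.containsAdditiveTuple_of_signs l (hM.col_ne_zero ht l)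
      (fun x => A r₀ x / M r₀ (w ⟨i, hli⟩).1) ?_ ?_ (fun l' => (w l').2) hzero fun l' => ?_)
    all_goals
      have hw0 : M r₀ (w ⟨i, hli⟩).1 ≠ 0 := by
        intro h
        refine hr₀ ?_
        rw [show j i = some (w ⟨i, hli⟩) from hw ⟨i, hli⟩]
        simp [frequency, h]
    · intro h
      have hA' : ∀ x, A r₀ x = 0 := fun x => by simpa [hw0] using congrFun h x
      exact hr₀ (by rw [hA]; simp [hA'])
    · simp only [div_mul_eq_mul_div, ← Finset.sum_div, hA0, zero_div]
    · simp only [div_mul_eq_mul_div, ← Finset.sum_div, ← hAw, hk l']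
      rw [mul_div_cancel_right₀ _ hw0]
  · push Not at hnone
    choose w hw using fun l => Option.ne_none_iff_exists'.1 (hnone l)
    obtain ⟨z, hz⟩ := exists_sum_units_eq Finset.univ fun l => (w l).2
    have : ∑ i, phase (j i) = (t : ℤ) - 2 * z := by
      rw [Finset.card_univ, Fintype.card_fin] at hz
      rw [← hz]
      exact Finset.sum_congr rfl fun l _ => by rw [hw]; rfl
    rw [this] at hN
    -- A sum of `t` signs is odd, whereas the modulus `t + 1` is even.
    obtain ⟨m, hm⟩ := hodd
    obtain ⟨y, hy⟩ := hN
    have : (2 * (m : ℤ) + 1) - 2 * z = 2 * ((m + 1) * y) := by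
      have h2 : (t : ℤ) = 2 * m + 1 := by exact_mod_cast hm
      rw [← h2, hy, hm]; push_cast; ring
    omega

end LinFormSystem

/-! ### The random-phase function and the additive tuple. -/

namespace LinFormSystem

variable {p t D : ℕ} [Fact p.Prime]

/-- The character of `𝔽_p²` of a given frequency. -/
noncomputable def planeChar (M : Matrix (Fin 2) (Fin t) (ZMod p)) (j : Option (Fin t × ℤˣ))
    (x : Fin 2 → ZMod p) : ℂ :=
  ∏ r, ZMod.stdAddChar (frequency M j r * x r)

/-- The coefficient of a frequency in `1/2 + ε • phaseFunction`. -/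
noncomputable def phaseCoeff (t : ℕ) (ε : ℝ) (θ : ZMod (t + 1)) : Option (Fin t × ℤˣ) → ℂ
  | none => 1 / 2
  | some (_, s) => (ε / (4 * t) : ℝ) * ZMod.stdAddChar (((s : ℤ) : ZMod (t + 1)) * θ)

/-- The real trigonometric polynomial whose frequencies are the columns of `M` up to sign, all
with the phase `θ`. -/
noncomputable def phaseFunction (M : Matrix (Fin 2) (Fin t) (ZMod p)) (θ : ZMod (t + 1))
    (x : Fin 2 → ZMod p) : ℝ :=
  (∑ k, (ZMod.stdAddChar θ * planeChar M (some (k, 1)) x : ℂ).re) / (2 * t)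

lemma planeChar_neg (M : Matrix (Fin 2) (Fin t) (ZMod p)) (k : Fin t) (x : Fin 2 → ZMod p) :
    planeChar M (some (k, -1)) x = (starRingEnd ℂ) (planeChar M (some (k, 1)) x) := by
  simp only [planeChar, map_prod, ← AddChar.map_neg_eq_conj]
  simp [frequency]

lemma norm_planeChar (M : Matrix (Fin 2) (Fin t) (ZMod p)) (j : Option (Fin t × ℤˣ))
    (x : Fin 2 → ZMod p) : ‖planeChar M j x‖ = 1 := by
  simp [planeChar, AddChar.norm_apply]

lemma abs_phaseFunction_le (M : Matrix (Fin 2) (Fin t) (ZMod p)) (θ : ZMod (t + 1))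
    (x : Fin 2 → ZMod p) : |phaseFunction M θ x| ≤ 1 / 2 := by
  rcases Nat.eq_zero_or_pos t with rfl | ht
  · simp [phaseFunction]
  have ht' : (0 : ℝ) < t := by exact_mod_cast ht
  rw [phaseFunction, abs_div, abs_of_pos (by positivity : (0 : ℝ) < 2 * t),
    div_le_div_iff₀ (by positivity) two_pos]
  have : |∑ k, (ZMod.stdAddChar θ * planeChar M (some (k, 1)) x : ℂ).re| ≤ ∑ _k : Fin t, (1 : ℝ) :=
    (Finset.abs_sum_le_sum_abs _ _).trans (Finset.sum_le_sum fun k _ =>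
      (Complex.abs_re_le_norm _).trans (by rw [norm_mul, norm_planeChar, AddChar.norm_apply]; simp))
  simp only [Finset.sum_const, Finset.card_univ, Fintype.card_fin, nsmul_eq_mul, mul_one] at this
  linarith

lemma sum_planeChar (M : Matrix (Fin 2) (Fin t) (ZMod p)) (hM : IsLinearlyGeneric M) (ht : 2 ≤ t)
    (q : Fin t × ℤˣ) : ∑ x, planeChar M (some q) x = 0 := by
  obtain ⟨r, hr⟩ := exists_frequency_ne_zero hM ht q
  simp only [planeChar]
  rw [← Fintype.prod_sum (fun r s => (ZMod.stdAddChar (frequency M (some q) r * s) : ℂ))]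
  refine Finset.prod_eq_zero (Finset.mem_univ r) ?_
  simp only [mul_comm, sum_stdAddChar_mul, if_neg hr]

lemma sum_phaseFunction (M : Matrix (Fin 2) (Fin t) (ZMod p)) (hM : IsLinearlyGeneric M)
    (ht : 2 ≤ t) (θ : ZMod (t + 1)) : ∑ x, phaseFunction M θ x = 0 := by
  simp only [phaseFunction, ← Finset.sum_div]
  rw [Finset.sum_comm]
  simp only [← Complex.re_sum, ← Finset.mul_sum, sum_planeChar M hM ht]
  simp

lemma sum_phaseCoeff_mul (M : Matrix (Fin 2) (Fin t) (ZMod p)) (θ : ZMod (t + 1)) (ε : ℝ)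
    (x : Fin 2 → ZMod p) :
    1 / 2 + (ε : ℂ) * (phaseFunction M θ x : ℂ) = ∑ j, phaseCoeff t ε θ j * planeChar M j x := by
  have hu : ∀ g : ℤˣ → ℂ, ∑ s, g s = g 1 + g (-1) := fun g => by
    rw [show (Finset.univ : Finset ℤˣ) = {1, -1} from rfl, Finset.sum_pair (by decide)]
  rw [Fintype.sum_option, Fintype.sum_prod_type]
  simp only [hu, planeChar_neg, phaseFunction, phaseCoeff]
  -- The constant `4t` in `phaseCoeff` is the `2t` of `phaseFunction` times the `2` from splitting a
  -- real part into a character and its conjugate.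
  have hk : ∀ k : Fin t,
      ((ε / (4 * t) : ℝ) : ℂ) * ZMod.stdAddChar ((((1 : ℤˣ) : ℤ) : ZMod (t + 1)) * θ) *
        planeChar M (some (k, 1)) x +
      ((ε / (4 * t) : ℝ) : ℂ) * ZMod.stdAddChar ((((-1 : ℤˣ) : ℤ) : ZMod (t + 1)) * θ) *
        (starRingEnd ℂ) (planeChar M (some (k, 1)) x) =
      ((ε / (2 * t) * (ZMod.stdAddChar θ * planeChar M (some (k, 1)) x : ℂ).re : ℝ) : ℂ) := by
    intro k
    have h1 : (ZMod.stdAddChar ((((-1 : ℤˣ) : ℤ) : ZMod (t + 1)) * θ) : ℂ) =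
        (starRingEnd ℂ) (ZMod.stdAddChar θ) := by
      rw [← AddChar.map_neg_eq_conj]; simp
    rw [h1, mul_assoc, mul_assoc, ← map_mul, ← mul_add]
    simp only [Units.val_one, Int.cast_one, one_mul]
    rw [Complex.add_conj]
    push_cast
    ring
  rw [Finset.sum_congr rfl fun k _ => hk k]
  simp only [planeChar, frequency, zero_mul, AddChar.map_zero_eq_one, Finset.prod_const_one,
    mul_one, ← Complex.ofReal_sum, ← Finset.mul_sum]
  push_cast
  ring

lemma stdAddChar_intCast_sum {ι : Type*} {N : ℕ} [NeZero N] (s : Finset ι) (f : ι → ℤ)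
    (θ : ZMod N) : (∏ i ∈ s, ZMod.stdAddChar ((f i : ZMod N) * θ) : ℂ) =
      ZMod.stdAddChar (θ * ((∑ i ∈ s, f i : ℤ) : ZMod N)) := by
  classical
  induction s using Finset.induction_on with
  | empty => simp
  | insert a s ha ih =>
    rw [Finset.prod_insert ha, ih, Finset.sum_insert ha, ← AddChar.map_add_eq_mul]
    congr 1
    push_cast
    ring

/-- The modulus of `phaseCoeff`. -/
noncomputable def phaseWeight (t : ℕ) (ε : ℝ) : Option (Fin t × ℤˣ) → ℝ
  | none => 1 / 2
  | some _ => ε / (4 * t)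

lemma phaseCoeff_eq (ε : ℝ) (θ : ZMod (t + 1)) (j : Option (Fin t × ℤˣ)) :
    phaseCoeff t ε θ j = phaseWeight t ε j * ZMod.stdAddChar ((phase j : ZMod (t + 1)) * θ) := by
  rcases j with _ | ⟨k, s⟩ <;> simp [phaseCoeff, phaseWeight, phase]

open Classical in
lemma form_phaseFunction (Ψ : LinFormSystem p t D) (M : Matrix (Fin 2) (Fin t) (ZMod p))
    (θ : ZMod (t + 1)) (ε : ℝ) :
    Ψ.form (Fin 2 → ZMod p) (fun _ x => 1 / 2 + (ε : ℂ) * (phaseFunction M θ x : ℂ)) =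
      ∑ j : Fin t → Option (Fin t × ℤˣ),
        ((if ∀ r, ∑ i, frequency M (j i) r • Ψ i = 0 then ∏ i, phaseWeight t ε (j i) else 0 : ℝ) : ℂ)
          * ZMod.stdAddChar (θ * ((∑ i, phase (j i) : ℤ) : ZMod (t + 1))) := by
  simp only [sum_phaseCoeff_mul]
  rw [form_expand]
  refine Finset.sum_congr rfl fun j _ => ?_
  rw [show (fun i => planeChar M (j i)) = fun i x => ∏ r, (ZMod.stdAddChar
      (frequency M (j i) r * x r) : ℂ) from rfl,
    form_pi Ψ (fun r i s => (ZMod.stdAddChar (frequency M (j i) r * s) : ℂ))]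
  simp only [form_linear, phaseCoeff_eq, Finset.prod_mul_distrib, stdAddChar_intCast_sum]
  rw [Finset.prod_ite_zero]
  simp only [Finset.mem_univ, true_implies]
  split_ifs <;> simp

lemma IsWeaklyLocallySidorenko.containsAdditiveTuple {Ψ : LinFormSystem p t D}
    (h : Ψ.IsWeaklyLocallySidorenko) {M : Matrix (Fin 2) (Fin t) (ZMod p)} (ht : 2 ≤ t)
    (hΨ : Ψ.IsDefinedBy M) (hM : IsLinearlyGeneric M) (hodd : Odd t) :
    Ψ.ContainsAdditiveTuple (t - 1) := by
  classical
  by_contra hno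
  have hev : ∀ᶠ ε : ℝ in nhdsWithin 0 (Set.Ioi 0), ∀ θ : ZMod (t + 1), (1 / 2) ^ t ≤
      (Ψ.form (Fin 2 → ZMod p) (fun _ x => 1 / 2 + (ε : ℂ) * (phaseFunction M θ x : ℂ))).re :=
    Filter.eventually_all.2 fun θ => h.le_form (phaseFunction M θ) (abs_phaseFunction_le M θ)
      (sum_phaseFunction M hM ht θ)
  obtain ⟨ε, hε, hε0⟩ := (hev.and self_mem_nhdsWithin).exists
  have hε0 : 0 < ε := hε0
  have ht0 : (0 : ℝ) < t := by exact_mod_cast (by omega : 0 < t)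
  let A : (Fin t → Option (Fin t × ℤˣ)) → ℝ := fun j =>
    if ∀ r, ∑ i, frequency M (j i) r • Ψ i = 0 then ∏ i, phaseWeight t ε (j i) else 0
  have hw : ∀ j, 0 < phaseWeight t ε j := by
    rintro (_ | q)
    · simp [phaseWeight]
    · simp only [phaseWeight]; positivity
  have hA : ∀ j, 0 ≤ A j := fun j => by
    simp only [A]
    split_ifs
    exacts [Finset.prod_nonneg fun i _ => (hw _).le, le_rfl]
  have hA0 : A (fun _ => none) = (1 / 2) ^ t := by
    simp [A, frequency, phaseWeight]
  have havg : ∑ θ : ZMod (t + 1), Ψ.form (Fin 2 → ZMod p)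
      (fun _ x => 1 / 2 + (ε : ℂ) * (phaseFunction M θ x : ℂ)) =
        (((t + 1 : ℕ) * (1 / 2) ^ t : ℝ) : ℂ) := by
    simp only [form_phaseFunction]
    rw [Finset.sum_comm, Finset.sum_eq_single (fun _ => none)]
    · rw [← Finset.mul_sum]
      change (A (fun _ => none) : ℂ) * _ = _
      rw [hA0]
      simp [phase, mul_comm]
    · intro j _ hj
      rw [← Finset.mul_sum, AddChar.sum_mulShift _ (ZMod.isPrimitive_stdAddChar _)]
      by_cases h1 : ∀ r, ∑ i, frequency M (j i) r • Ψ i = 0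
      · rw [if_neg (c := ((∑ i, phase (j i) : ℤ) : ZMod (t + 1)) = 0), Nat.cast_zero, mul_zero]
        rw [ZMod.intCast_zmod_eq_zero_iff_dvd]
        exact fun hd => hj (funext (hΨ.frequency_eq_none hM ht hodd hno j h1 hd))
      · rw [if_neg h1, Complex.ofReal_zero, zero_mul]
    · simp
  have hone : (1 / 2) ^ t < (Ψ.form (Fin 2 → ZMod p)
      (fun _ x => 1 / 2 + (ε : ℂ) * (phaseFunction M 0 x : ℂ))).re := by
    rw [form_phaseFunction]
    simp only [zero_mul, AddChar.map_zero_eq_one, mul_one, ← Complex.ofReal_sum,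
      Complex.ofReal_re]
    change _ < ∑ j, A j
    -- Choosing column `i` for form `i` makes the two coordinates the rows of `M` themselves, so
    -- this nontrivial term survives.
    have hne : (fun _ => none : Fin t → Option (Fin t × ℤˣ)) ≠ fun i => some (i, 1) :=
      fun h => by simpa using congrFun h ⟨0, by omega⟩
    have hAid : 0 < A fun i => some (i, 1) := by
      simp only [A]
      rw [if_pos]
      · exact Finset.prod_pos fun i _ => hw _
      · intro r
        exact (hΨ.sum_smul_eq_zero_iff _).2 ⟨Pi.single r 1, fun i => by
          simp [frequency, Pi.single_apply]⟩
    refine lt_of_lt_of_le ?_ (Finset.sum_le_sum_of_subset_of_nonneg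
      (Finset.subset_univ {fun _ => none, fun i => some (i, 1)}) fun j _ _ => hA j)
    rw [Finset.sum_pair hne, hA0]
    linarith
  have hlt : ∑ _θ : ZMod (t + 1), ((1 : ℝ) / 2) ^ t < ∑ θ : ZMod (t + 1), (Ψ.form (Fin 2 → ZMod p)
      (fun _ x => 1 / 2 + (ε : ℂ) * (phaseFunction M θ x : ℂ))).re :=
    Finset.sum_lt_sum (fun θ _ => hε θ) ⟨0, Finset.mem_univ _, hone⟩
  rw [← Complex.re_sum, havg, Complex.ofReal_re] at hlt
  simp at hlt

end LinFormSystem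

/-! ### Three forms. -/

namespace LinFormSystem

variable {p t D : ℕ} [Fact p.Prime]

lemma expect_comp_dual {ψ : Module.Dual (ZMod p) (Fin D → ZMod p)} (hψ : ψ ≠ 0)
    (H : ZMod p → ℂ) : 𝔼 x, H (ψ x) = 𝔼 s, H s := by
  obtain ⟨w, hw⟩ : ∃ w, ψ w = 1 := by
    obtain ⟨u, hu⟩ := DFunLike.ne_iff.1 hψ
    exact ⟨(ψ u)⁻¹ • u, by rw [map_smul, smul_eq_mul, inv_mul_cancel₀ (by simpa using hu)]⟩
  have h1 : ∀ s : ZMod p, 𝔼 x, H (ψ x) = 𝔼 x, H (ψ x + s) := fun s =>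
    (Fintype.expect_equiv (Equiv.addRight (s • w)) _ _ fun x => by simp [hw]).symm
  have h2 : ∀ u : ZMod p, 𝔼 s, H (u + s) = 𝔼 s, H s := fun u =>
    Fintype.expect_equiv (Equiv.addLeft u) _ _ fun s => rfl
  calc 𝔼 x, H (ψ x) = 𝔼 _s : ZMod p, 𝔼 x, H (ψ x) := (Fintype.expect_const _).symm
    _ = 𝔼 s : ZMod p, 𝔼 x, H (ψ x + s) := Finset.expect_congr rfl fun s _ => h1 s
    _ = 𝔼 x, 𝔼 s : ZMod p, H (ψ x + s) := Finset.expect_comm _ _ _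
    _ = 𝔼 s, H s := by simp only [h2, Fintype.expect_const]

/-- Half the difference of the point masses at `1` and `v`. -/
noncomputable def dipole (v s : ZMod p) : ℝ :=
  ((if s = 1 then 1 else 0) - (if s = v then 1 else 0)) / 2

lemma sum_dipole_mul (v : ZMod p) (g : ZMod p → ℝ) :
    ∑ s, dipole v s * g s = (g 1 - g v) / 2 := by
  simp only [dipole, div_mul_eq_mul_div, sub_mul, ← Finset.sum_div, Finset.sum_sub_distrib,
    ite_mul, one_mul, zero_mul, Finset.sum_ite_eq', Finset.mem_univ, if_true]

/-- The first-order terms vanish. If `v² = 1` the quadratic term is negative; otherwise it cancels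
and the cubic term is negative. -/
lemma sum_dipole_count_lt {v : ZMod p} (hv0 : v ≠ 0) (hv1 : v ≠ 1) {ε : ℝ} (hε : 0 < ε) :
    ∑ s, (1 / 2 + ε * dipole v s) ^ 2 * (1 / 2 + ε * dipole v (v * s)) < (p : ℝ) * (1 / 2) ^ 3 := by
  have hmul : ∑ s, dipole v (v * s) = 0 := by
    rw [← Equiv.sum_comp (Equiv.mulLeft₀ v hv0).symm]
    simpa [mul_inv_cancel_left₀ hv0] using sum_dipole_mul v fun _ => 1
  have h : ∀ s, (1 / 2 + ε * dipole v s) ^ 2 * (1 / 2 + ε * dipole v (v * s)) =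
      1 / 8 + ε / 4 * dipole v (v * s) + dipole v s * (ε / 2 + ε ^ 2 / 2 * dipole v s +
        ε ^ 2 * dipole v (v * s) + ε ^ 3 * (dipole v s * dipole v (v * s))) := fun s => by ring
  simp only [h, Finset.sum_add_distrib, ← Finset.mul_sum, hmul, sum_dipole_mul]
  have hvv : v * v ≠ v := fun h => hv1 (mul_right_cancel₀ hv0 (by rw [h, one_mul]))
  by_cases hv : v * v = 1
  · simp [dipole, hv1, hv1.symm, hv]
    nlinarith [pow_pos hε 2]
  · simp [dipole, hv1, hv1.symm, hv, hvv]
    nlinarith [pow_pos hε 2, pow_pos hε 3]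

lemma IsWeaklyLocallySidorenko.eq_of_three {Ψ : LinFormSystem p 3 D}
    (h : Ψ.IsWeaklyLocallySidorenko) {M : Matrix (Fin 2) (Fin 3) (ZMod p)}
    (hΨ : Ψ.IsDefinedBy M) (hM : IsLinearlyGeneric M) (i j : Fin 3) : Ψ i = Ψ j := by
  classical
  obtain ⟨e, he⟩ := h.containsAdditiveTuple (by norm_num) hΨ hM (by decide)
  have heq : Ψ (e 0) = Ψ (e 1) := by
    ext d
    have := (he _).1 ⟨Pi.single d 1, rfl⟩
    -- The index type is `Fin (3 - 1)`, which is `Fin 2` only after unfolding.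
    erw [Fin.sum_univ_two] at this
    simpa [← sub_eq_add_neg, sub_eq_zero] using this
  have he01 : e 0 ≠ e 1 := fun h => by simpa using e.injective h
  obtain ⟨l, hl⟩ : ∃ l, l ∉ ({e 0, e 1} : Finset (Fin 3)) := by
    by_contra! hall
    have := Finset.card_le_card (fun l _ => hall l : Finset.univ ⊆ ({e 0, e 1} : Finset (Fin 3)))
    rw [Finset.card_pair he01] at this
    simp at this
  rw [Finset.mem_insert, Finset.mem_singleton, not_or] at hl
  have huniv : (Finset.univ : Finset (Fin 3)) = {e 0, e 1, l} :=
    (Finset.eq_univ_of_card _ (by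
      rw [Finset.card_eq_three.2 ⟨e 0, e 1, l, he01, Ne.symm hl.1, Ne.symm hl.2, rfl⟩]; simp)).symm
  have hn1 : e 0 ∉ ({e 1, l} : Finset (Fin 3)) := by simp [he01, Ne.symm hl.1]
  have hn2 : e 1 ∉ ({l} : Finset (Fin 3)) := by simp [Ne.symm hl.2]
  -- Eliminating `e 1` leaves a relation between the other two forms with both coefficients nonzero.
  have hrel := (hΨ.sum_smul_eq_zero_iff _).2 ⟨eliminate M (e 1), fun _ => rfl⟩
  simp only [sum_eliminate_mul] at hrel
  rw [huniv, Finset.sum_insert hn1, Finset.sum_insert hn2, Finset.sum_singleton, sub_self,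
    zero_smul, zero_add] at hrel
  have hc0 := hM.minor_ne_zero he01.symm
  have hcl := hM.minor_ne_zero (Ne.symm hl.2)
  set c0 := M 0 (e 1) * M 1 (e 0) - M 0 (e 0) * M 1 (e 1)
  set cl := M 0 (e 1) * M 1 l - M 0 l * M 1 (e 1)
  set v : ZMod p := -c0 / cl with hv
  have hv0 : v ≠ 0 := div_ne_zero (neg_ne_zero.2 hc0) hcl
  have hΨl : Ψ l = v • Ψ (e 0) := by
    rw [hv, div_eq_inv_mul, mul_smul, neg_smul, neg_eq_of_add_eq_zero_right hrel, smul_smul,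
      inv_mul_cancel₀ hcl, one_smul]
  suffices hall : ∀ i, Ψ i = Ψ (e 0) by rw [hall i, hall j]
  by_contra hne
  have hψ : Ψ (e 0) ≠ 0 := by
    intro h0
    refine hne fun i => ?_
    have := Finset.mem_univ i
    rw [huniv, Finset.mem_insert, Finset.mem_insert, Finset.mem_singleton] at this
    rcases this with rfl | rfl | rfl
    · rfl
    · exact heq.symm
    · rw [hΨl, h0, smul_zero]
  have hv1 : v ≠ 1 := by
    intro h1
    refine hne fun i => ?_
    have := Finset.mem_univ i
    rw [huniv, Finset.mem_insert, Finset.mem_insert, Finset.mem_singleton] at this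
    rcases this with rfl | rfl | rfl
    · rfl
    · exact heq.symm
    · rw [hΨl, h1, one_smul]
  obtain ⟨ε, hle, hε⟩ := ((h.le_form (dipole v) (fun s => by
    rw [dipole, abs_div, abs_of_pos (two_pos : (0 : ℝ) < 2)]
    refine div_le_div_of_nonneg_right ?_ two_pos.le
    split_ifs <;> simp) (by simpa using sum_dipole_mul v fun _ => 1)).and
      self_mem_nhdsWithin).exists
  have hform : Ψ.form (ZMod p) (fun _ s => 1 / 2 + (ε : ℂ) * (dipole v s : ℂ)) =
      (((∑ s, (1 / 2 + ε * dipole v s) ^ 2 * (1 / 2 + ε * dipole v (v * s))) / p : ℝ) : ℂ) := by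
    have hexp := expect_comp_dual hψ fun s => (1 / 2 + (ε : ℂ) * dipole v s) ^ 2 *
      (1 / 2 + (ε : ℂ) * dipole v (v * s))
    refine Eq.trans ?_ (hexp.trans ?_)
    · rw [form]
      refine Finset.expect_congr rfl fun x _ => ?_
      simp only [sum_single_smul]
      rw [huniv, Finset.prod_insert hn1, Finset.prod_insert hn2, Finset.prod_singleton, hΨl, ← heq]
      simp only [LinearMap.smul_apply, smul_eq_mul]
      ring
    · rw [Fintype.expect_eq_sum_div_card, ZMod.card]
      push_cast
      rfl
  rw [hform, Complex.ofReal_re, le_div_iff₀ (by exact_mod_cast (Fact.out : p.Prime).pos),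
    mul_comm] at hle
  exact absurd hle (not_le.2 (sum_dipole_count_lt hv0 hv1 hε))

end LinFormSystem

/-! ### Isotropic weights for the row space. -/

section Generic

variable {p t : ℕ} [Fact p.Prime] {M : Matrix (Fin 2) (Fin t) (ZMod p)}

/-- For odd `t` the columns of `M` cannot exhaust the projective line. -/
lemma IsLinearlyGeneric.exists_row_ne_zero (h : IsLinearlyGeneric M) (ht : 4 ≤ t) (hodd : Odd t) :
    ∃ n : Fin 2 → ZMod p, ∀ i, ∑ r, n r * M r i ≠ 0 := by
  -- The columns are distinct points of the projective line, with `none` at infinity. As `p` is odd,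
  -- the line has `p + 1 ≠ t` points, and a missed point gives a functional nonzero on every column.
  let g : Fin t → Option (ZMod p) := fun i => if M 0 i = 0 then none else some (M 1 i / M 0 i)
  have hg : Function.Injective g := by
    intro i j hij
    refine h.eq_of_minor_eq_zero ?_
    by_cases hi : M 0 i = 0 <;> by_cases hj : M 0 j = 0 <;> simp [g, hi, hj] at hij ⊢
    rw [div_eq_div_iff hi hj] at hij
    linear_combination -hij
  have hcard : t ≤ p + 1 := by simpa using Fintype.card_le_of_injective g hg
  have hpodd : Odd p := (Fact.out : p.Prime).odd_of_ne_two (by omega)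
  have hns : ¬ Function.Surjective g := by
    intro hs
    have : t = p + 1 := by simpa using Fintype.card_of_bijective ⟨hg, hs⟩
    rw [Nat.odd_iff] at hodd hpodd
    omega
  rw [Function.Surjective, not_forall] at hns
  obtain ⟨o, ho⟩ := hns
  rw [not_exists] at ho
  rcases o with _ | s
  · refine ⟨![1, 0], fun i hi => ho i ?_⟩
    simp [g, Fin.sum_univ_two] at hi ⊢
    exact hi
  · refine ⟨![s, -1], fun i hi => ?_⟩
    simp [Fin.sum_univ_two] at hi
    by_cases h0 : M 0 i = 0
    · obtain ⟨r, hr⟩ := h.col_ne_zero (by omega) i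
      have h1 : M 1 i = 0 := by rw [h0] at hi; linear_combination -hi
      exact hr (by revert r; exact fun r hr => (by fin_cases r <;> first | exact h0 | exact h1))
    · refine ho i ?_
      simp only [g, if_neg h0, Option.some.injEq]
      rw [div_eq_iff h0]
      linear_combination -hi

/-- Weights without zeros for which the row space of `M` is totally isotropic. -/
lemma IsLinearlyGeneric.exists_weights (h : IsLinearlyGeneric M) (ht : 4 ≤ t)
    {n : Fin 2 → ZMod p} (hn : ∀ i, ∑ r, n r * M r i ≠ 0) :
    ∃ c : Fin t → ZMod p, (∀ i, c i ≠ 0) ∧ ∀ r r', ∑ i, (c i)⁻¹ * M r i * M r' i = 0 := by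
  classical
  -- Scaling column `i` by `1 / d i` moves all columns to an affine line with distinct coordinates
  -- `x i`, on which the rows are polynomials of degree at most 1.
  set d : Fin t → ZMod p := fun i => ∑ r, n r * M r i with hd
  obtain ⟨x, α, β, hx⟩ : ∃ (x : Fin t → ZMod p) (α β : Fin 2 → ZMod p),
      ∀ r i, M r i = d i * (α r + β r * x i) := by
    by_cases h1 : n 1 = 0
    · have h0 : n 0 ≠ 0 := fun h0 => hn ⟨0, by omega⟩ (by simp [Fin.sum_univ_two, h0, h1])
      refine ⟨fun i => M 1 i / d i, ![1 / n 0, 0], ![0, 1], Fin.forall_fin_two.2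
        ⟨fun i => ?_, fun i => ?_⟩⟩ <;> have hdi : d i ≠ 0 := hn i
      · simp [hd, Fin.sum_univ_two, h1]
        field_simp
      · simp; field_simp
    · refine ⟨fun i => M 0 i / d i, ![0, 1 / n 1], ![1, -n 0 / n 1], Fin.forall_fin_two.2
        ⟨fun i => ?_, fun i => ?_⟩⟩ <;> have hdi : d i ≠ 0 := hn i
      · simp; field_simp
      · simp
        field_simp
        simp only [hd, Fin.sum_univ_two]
        ring
  have hinj : Set.InjOn x (Finset.univ : Finset (Fin t)) := by
    intro i _ j _ hij
    refine h.eq_of_minor_eq_zero ?_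
    rw [hx 0 i, hx 1 i, hx 0 j, hx 1 j, hij]
    ring
  let w : Fin t → ZMod p := fun i => ∏ j ∈ Finset.univ.erase i, (x i - x j)
  have hw : ∀ i, w i ≠ 0 := fun i => Finset.prod_ne_zero_iff.2 fun j hj => sub_ne_zero.2 fun hij =>
    Finset.ne_of_mem_erase hj (hinj (Finset.mem_univ j) (Finset.mem_univ i) hij.symm)
  refine ⟨fun i => w i * d i ^ 2, fun i => mul_ne_zero (hw i) (pow_ne_zero 2 (hn i)),
    fun r r' => ?_⟩
  let P : Fin 2 → Polynomial (ZMod p) := fun r => Polynomial.C (β r) * Polynomial.X +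
    Polynomial.C (α r)
  have hdeg : (P r * P r').natDegree ≤ 2 := Polynomial.natDegree_mul_le.trans
    (add_le_add Polynomial.natDegree_linear_le Polynomial.natDegree_linear_le)
  -- By Lagrange interpolation the weighted sum is the coefficient of degree `t - 1` in `P r * P
  -- r'`, which is zero because `2 < t - 1 + 0` for `t ≥ 4`.
  have hlag := Lagrange.coeff_eq_sum hinj (P := P r * P r') (by
    rw [Finset.card_univ, Fintype.card_fin]
    exact Polynomial.degree_le_natDegree.trans_lt (by exact_mod_cast (by omega)))
  rw [Polynomial.coeff_eq_zero_of_natDegree_lt (by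
    rw [Finset.card_univ, Fintype.card_fin]; omega)] at hlag
  rw [hlag]
  refine Finset.sum_congr rfl fun i _ => ?_
  have hdi : d i ≠ 0 := hn i
  have hwi := hw i
  change _ = _ / w i
  rw [hx r, hx r']
  simp [P]
  field_simp
  ring

end Generic

/-! ### Kernels of the Gram forms. -/

namespace LinFormSystem

variable {p t D : ℕ} [Fact p.Prime]

/-- The symmetric bilinear form `∑ i, c i • Ψ i ⊗ Ψ i`, as a map to the dual. -/
noncomputable def gram (Ψ : LinFormSystem p t D) (c : Fin t → ZMod p) :
    (Fin D → ZMod p) →ₗ[ZMod p] Module.Dual (ZMod p) (Fin D → ZMod p) :=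
  ∑ i, c i • (Ψ i).smulRight (Ψ i)

lemma gram_apply (Ψ : LinFormSystem p t D) (c : Fin t → ZMod p) (Y : Fin D → ZMod p) :
    Ψ.gram c Y = ∑ i, (c i * Ψ i Y) • Ψ i := by
  simp [gram, smul_smul]

open Classical in
lemma form_bilinear_eq (Ψ : LinFormSystem p t D) (c : Fin t → ZMod p) :
    Ψ.form (ZMod p × ZMod p) (fun i s => ZMod.stdAddChar (c i * (s.1 * s.2))) =
      (((p : ℝ) ^ Module.finrank (ZMod p) (LinearMap.ker (Ψ.gram c)) / (p : ℝ) ^ D : ℝ) : ℂ) := by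
  have h : (Finset.univ.filter fun Y : Fin D → ZMod p => ∑ i, (c i * Ψ i Y) • Ψ i = 0).card =
      p ^ Module.finrank (ZMod p) (LinearMap.ker (Ψ.gram c)) := by
    have hK := Module.card_eq_pow_finrank (K := ZMod p) (V := LinearMap.ker (Ψ.gram c))
    rw [ZMod.card] at hK
    rw [← hK, Fintype.card_subtype]
    congr 1
    ext Y
    simp [LinearMap.mem_ker, gram_apply]
  rw [form_bilinear, h]
  push_cast
  rfl

variable {Ψ : LinFormSystem p t D} {M : Matrix (Fin 2) (Fin t) (ZMod p)}

/-- For `Y` in the kernel, `c l * Ψ_l(Y)` is a row vector vanishing at `i`. If one further `Ψ_j(Y)`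
vanishes, it has two zeros and is zero, so a single linear condition cuts the kernel down to `ker
Ψ`. -/
lemma IsDefinedBy.finrank_ker_gram_le (hΨ : Ψ.IsDefinedBy M) (hM : IsLinearlyGeneric M)
    (ht : 2 ≤ t) {c : Fin t → ZMod p} {i : Fin t} (hc : ∀ j, j ≠ i → c j ≠ 0) (hi : c i = 0) :
    Module.finrank (ZMod p) (LinearMap.ker (Ψ.gram c)) ≤
      Module.finrank (ZMod p) (LinearMap.ker (LinearMap.pi Ψ)) + 1 := by
  have : Nontrivial (Fin t) := Fin.nontrivial_iff_two_le.2 ht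
  obtain ⟨j, hj⟩ := exists_ne i
  let q := (Ψ j).domRestrict (LinearMap.ker (Ψ.gram c))
  have h1 := LinearMap.finrank_range_add_finrank_ker q
  have h2 : Module.finrank (ZMod p) (LinearMap.range q) ≤ 1 :=
    (Submodule.finrank_le _).trans (Module.finrank_self _).le
  have h3 : Module.finrank (ZMod p) (LinearMap.ker q) ≤
      Module.finrank (ZMod p) (LinearMap.ker (LinearMap.pi Ψ)) := by
    rw [← Submodule.finrank_map_subtype_eq]
    refine Submodule.finrank_mono ?_
    rintro _ ⟨⟨Y, hY⟩, hqY, rfl⟩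
    have hjY : Ψ j Y = 0 := hqY
    rw [LinearMap.mem_ker, gram_apply] at hY
    have h0 : (fun l => c l * Ψ l Y) = 0 := by
      by_contra hne
      exact hj (hΨ.unique_zero hM hne hY (i := i) (j := j) (by simp [hi]) (by simp [hjY]))
    have hl : ∀ l, l ≠ i → Ψ l Y = 0 := fun l hl =>
      (mul_eq_zero.1 (congrFun h0 l)).resolve_left (hc l hl)
    have hiY : Ψ i Y = 0 := by
      have hmem : LinearMap.pi Ψ Y ∈ LinearMap.ker M.mulVecLin := hΨ ▸ ⟨Y, rfl⟩
      obtain ⟨r, hr⟩ := hM.col_ne_zero ht i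
      have := congrFun (LinearMap.mem_ker.1 hmem) r
      simp only [Matrix.mulVecLin_apply, Matrix.mulVec, dotProduct, LinearMap.pi_apply,
        Pi.zero_apply] at this
      rw [Finset.sum_eq_single i (fun l _ h => by rw [hl l h, mul_zero]) (by simp)] at this
      exact (mul_eq_zero.1 this).resolve_left hr
    rw [LinearMap.mem_ker]
    ext l
    by_cases h : l = i
    · rw [h]; exact hiY
    · exact hl l h
  omega

/-- Isotropy puts the rows of `M`, divided by `c`, into `ker M`, the image of `Ψ`. Their preimages
lie in the Gram kernel and add two dimensions to `ker Ψ`. -/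
lemma IsDefinedBy.le_finrank_ker_gram (hΨ : Ψ.IsDefinedBy M) (hM : IsLinearlyGeneric M)
    (ht : 2 ≤ t) {c : Fin t → ZMod p} (hc : ∀ j, c j ≠ 0)
    (hiso : ∀ r r', ∑ i, (c i)⁻¹ * M r i * M r' i = 0) :
    Module.finrank (ZMod p) (LinearMap.ker (LinearMap.pi Ψ)) + 2 ≤
      Module.finrank (ZMod p) (LinearMap.ker (Ψ.gram c)) := by
  have hY : ∀ r, ∃ Y, ∀ i, Ψ i Y = (c i)⁻¹ * M r i := by
    intro r
    have : (fun i => (c i)⁻¹ * M r i) ∈ LinearMap.range (LinearMap.pi Ψ) := by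
      rw [hΨ, LinearMap.mem_ker]
      ext r'
      simpa [Matrix.mulVec, dotProduct, mul_comm, mul_left_comm, mul_assoc] using hiso r r'
    obtain ⟨Y, hY⟩ := this
    exact ⟨Y, fun i => congrFun hY i⟩
  choose Y hY using hY
  let g := (Fintype.linearCombination (ZMod p) Y).coprod
    (LinearMap.ker (LinearMap.pi Ψ)).subtype
  have hg : ∀ a i, Ψ i (g a) = (c i)⁻¹ * ∑ r, a.1 r * M r i := by
    rintro ⟨a, κ, hκ⟩ i
    have : Ψ i κ = 0 := congrFun (LinearMap.mem_ker.1 hκ) i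
    simp [g, Fintype.linearCombination_apply, hY, this, mul_left_comm, mul_add]
  have hinj : Function.Injective g := by
    rw [← LinearMap.ker_eq_bot, LinearMap.ker_eq_bot']
    intro a ha
    have h0 : ∀ i, ∑ r, a.1 r * M r i = 0 := fun i => by
      have := hg a i
      rw [ha, map_zero] at this
      exact (mul_eq_zero.1 this.symm).resolve_left (inv_ne_zero (hc i))
    have ha1 : a.1 = 0 := hM.eq_zero_of_two_zeros (i := ⟨0, by omega⟩) (j := ⟨1, by omega⟩)
      (by simp) (h0 _) (h0 _)
    have ha2 : (a.2 : Fin D → ZMod p) = 0 := by simpa [g, ha1] using ha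
    exact Prod.ext ha1 (Subtype.ext ha2)
  have hle : LinearMap.range g ≤ LinearMap.ker (Ψ.gram c) := by
    rintro _ ⟨a, rfl⟩
    rw [LinearMap.mem_ker, gram_apply, hΨ.sum_smul_eq_zero_iff]
    exact ⟨a.1, fun i => by rw [hg, mul_inv_cancel_left₀ (hc i)]⟩
  have := Submodule.finrank_mono hle
  rw [LinearMap.finrank_range_of_inj hinj, Module.finrank_prod, Module.finrank_fin_fun] at this
  omega

end LinFormSystem

/-! ### The quadric function, which excludes odd `t ≥ 5`. -/

namespace LinFormSystem

variable {p t D : ℕ} [Fact p.Prime]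

/-- The coefficients, indexed by pairs of characters, of `1/2 - δ • (u ⊗ u)` with
`u = centredDelta p`. -/
noncomputable def tensorCoeff (p : ℕ) (δ : ℝ) (j : ZMod p × ZMod p) : ℝ :=
  if j = 0 then 1 / 2 else if j.1 ≠ 0 ∧ j.2 ≠ 0 then -δ else 0

lemma sum_tensorCoeff_mul (δ : ℝ) (z Q : ZMod p) :
    ∑ j : ZMod p × ZMod p, (tensorCoeff p δ j : ℂ) *
      (ZMod.stdAddChar (j.2 * z) * ZMod.stdAddChar (j.1 * Q)) =
      1 / 2 - δ * (centredDelta p z * centredDelta p Q) := by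
  have h : ∀ j : ZMod p × ZMod p, (tensorCoeff p δ j : ℂ) *
      (ZMod.stdAddChar (j.2 * z) * ZMod.stdAddChar (j.1 * Q)) =
      (if j = 0 then 1 / 2 else 0) - δ * (((if j.1 = 0 then 0 else 1) *
        ZMod.stdAddChar (j.1 * Q)) * ((if j.2 = 0 then 0 else 1) * ZMod.stdAddChar (j.2 * z))) := by
    rintro ⟨c, d⟩
    by_cases hc : c = 0 <;> by_cases hd : d = 0 <;>
      simp [tensorCoeff, hc, hd, Prod.ext_iff, mul_comm]
  have hprod := Finset.sum_mul_sum Finset.univ Finset.univ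
    (fun c : ZMod p => (if c = 0 then 0 else 1) * (ZMod.stdAddChar (c * Q) : ℂ))
    (fun d : ZMod p => (if d = 0 then 0 else 1) * (ZMod.stdAddChar (d * z) : ℂ))
  rw [sum_ite_stdAddChar, sum_ite_stdAddChar] at hprod
  rw [Finset.sum_congr rfl fun j _ => h j, Finset.sum_sub_distrib, ← Finset.mul_sum,
    Finset.sum_ite_eq', if_pos (Finset.mem_univ _), Fintype.sum_prod_type, ← hprod, mul_comm
    (centredDelta p z : ℂ)]

/-- The tensor product of a centred point mass with the centred indicator of the zeros of a
hyperbolic quadratic form, scaled to be at most `1/2`. -/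
noncomputable def quadricFunction (p m : ℕ) [Fact p.Prime]
    (v : ZMod p × (Fin m → ZMod p × ZMod p)) : ℝ :=
  -(centredDelta p v.1 * centredDelta p (∑ k, (v.2 k).1 * (v.2 k).2) / (2 * p ^ 2))

lemma abs_quadricFunction_le (m : ℕ) (v : ZMod p × (Fin m → ZMod p × ZMod p)) :
    |quadricFunction p m v| ≤ 1 / 2 := by
  have hp : (0 : ℝ) < p := by exact_mod_cast (Fact.out : p.Prime).pos
  rw [quadricFunction, abs_neg, abs_div, abs_mul, abs_of_pos (by positivity : (0 : ℝ) < 2 * p ^ 2),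
    div_le_div_iff₀ (by positivity) two_pos]
  nlinarith [mul_le_mul (abs_centredDelta_le v.1)
    (abs_centredDelta_le (∑ k, (v.2 k).1 * (v.2 k).2)) (abs_nonneg _) hp.le]

lemma sum_quadricFunction (m : ℕ) : ∑ v, quadricFunction p m v = 0 := by
  simp only [quadricFunction, Finset.sum_neg_distrib, ← Finset.sum_div, Fintype.sum_prod_type,
    ← Finset.mul_sum, ← Finset.sum_mul, sum_centredDelta]
  simp

open Classical in
lemma form_quadricFunction (Ψ : LinFormSystem p t D) (m : ℕ) (ε : ℝ) :
    Ψ.form (ZMod p × (Fin m → ZMod p × ZMod p))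
      (fun _ v => 1 / 2 + (ε : ℂ) * (quadricFunction p m v : ℂ)) =
      ((∑ j : Fin t → ZMod p × ZMod p, (∏ i, tensorCoeff p (ε / (2 * p ^ 2)) (j i)) *
        ((if ∑ i, (j i).2 • Ψ i = 0 then 1 else 0) *
        ((p : ℝ) ^ Module.finrank (ZMod p) (LinearMap.ker (Ψ.gram fun i => (j i).1)) /
          (p : ℝ) ^ D) ^ m) : ℝ) : ℂ) := by
  have h1 : ∀ v : ZMod p × (Fin m → ZMod p × ZMod p),
      1 / 2 + (ε : ℂ) * (quadricFunction p m v : ℂ) =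
      ∑ j : ZMod p × ZMod p, (tensorCoeff p (ε / (2 * p ^ 2)) j : ℂ) *
        (ZMod.stdAddChar (j.2 * v.1) *
          ∏ k, ZMod.stdAddChar (j.1 * ((v.2 k).1 * (v.2 k).2))) := by
    intro v
    simp only [← stdAddChar_sum, ← Finset.mul_sum]
    rw [sum_tensorCoeff_mul, quadricFunction]
    push_cast
    ring
  simp only [h1]
  rw [form_expand]
  push_cast
  refine Finset.sum_congr rfl fun j _ => ?_
  congr 1
  rw [form_prod Ψ (fun i z => (ZMod.stdAddChar ((j i).2 * z) : ℂ))
    (fun i (w : Fin m → ZMod p × ZMod p) => ∏ k, (ZMod.stdAddChar ((j i).1 * ((w k).1 * (w k).2)) : ℂ)),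
    form_pi Ψ (fun _ i (s : ZMod p × ZMod p) => (ZMod.stdAddChar ((j i).1 * (s.1 * s.2)) : ℂ)), form_linear,
    form_bilinear_eq Ψ fun i => (j i).1]
  split_ifs <;> simp [div_pow]

lemma IsLocallySidorenko.lt_four {Ψ : LinFormSystem p t D} (h : Ψ.IsLocallySidorenko)
    {M : Matrix (Fin 2) (Fin t) (ZMod p)} (hΨ : Ψ.IsDefinedBy M)
    (hM : IsLinearlyGeneric M) (hodd : Odd t) : t < 4 := by
  classical
  by_contra! ht
  obtain ⟨ε, hε, hle⟩ := h.le_form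
  obtain ⟨n, hn⟩ := hM.exists_row_ne_zero ht hodd
  obtain ⟨c₀, hc₀, hiso⟩ := hM.exists_weights ht hn
  have hp1 : (1 : ℝ) < p := by exact_mod_cast (Fact.out : p.Prime).one_lt
  have hp0 : (0 : ℝ) < p := by linarith
  set δ : ℝ := ε / (2 * p ^ 2) with hδ
  have hδ0 : 0 < δ := by positivity
  -- There are `(p * p)^t` index tuples, each with positive part at most `δ^(t-1) κ^m / 2` apart
  -- from the trivial one; the tuple `j₀` contributes at most `-δ^t (p κ)^m`, so `p^m δ` must exceed
  -- their number.
  obtain ⟨m, hm⟩ := pow_unbounded_of_one_lt (((p : ℝ) * p) ^ t / δ) hp1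
  rw [div_lt_iff₀ hδ0] at hm
  have hle := hle _ (quadricFunction p m) (abs_quadricFunction_le m) (sum_quadricFunction m)
  rw [form_quadricFunction, Complex.ofReal_re, ← hδ] at hle
  set K := Module.finrank (ZMod p) (LinearMap.ker (LinearMap.pi Ψ))
  let R : (Fin t → ZMod p) → ℝ := fun c =>
    (p : ℝ) ^ Module.finrank (ZMod p) (LinearMap.ker (Ψ.gram c)) / (p : ℝ) ^ D
  have hR : ∀ c, 0 < R c := fun c => by simp only [R]; positivity
  set κ : ℝ := (p : ℝ) ^ (K + 1) / (p : ℝ) ^ D with hκ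
  have hκ0 : 0 < κ := by positivity
  let B : (Fin t → ZMod p × ZMod p) → ℝ := fun j => (∏ i, tensorCoeff p δ (j i)) *
    ((if ∑ i, (j i).2 • Ψ i = 0 then 1 else 0) * R (fun i => (j i).1) ^ m)
  let d₀ : Fin t → ZMod p := fun i => ∑ r, n r * M r i
  let j₀ : Fin t → ZMod p × ZMod p := fun i => (c₀ i, d₀ i)
  have hpow : ∀ j : Fin t → ZMod p × ZMod p, (∀ i, (j i).1 ≠ 0 ∧ (j i).2 ≠ 0) →
      ∏ i, tensorCoeff p δ (j i) = -δ ^ t := fun j hj => by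
    rw [Finset.prod_congr rfl (g := fun _ => -δ) fun i _ => by
      rw [tensorCoeff, if_neg fun h0 => (hj i).1 (by rw [h0]; rfl), if_pos (hj i)]]
    simp [hodd.neg_pow]
  have hB : ∀ j, B j ≤ 1 / 2 * δ ^ (t - 1) * κ ^ m + (if j = 0 then (1 / 2) ^ t else 0) +
      (if j = j₀ then -(δ ^ t * (p * κ) ^ m) else 0) := by
    intro j
    have hpos : 0 < 1 / 2 * δ ^ (t - 1) * κ ^ m := by positivity
    by_cases h1 : j = j₀
    · have hBj : B j ≤ -(δ ^ t * (p * κ) ^ m) := by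
        have hle' : (p * κ) ^ m ≤ R c₀ ^ m := by
          refine pow_le_pow_left₀ (by positivity) ?_ m
          rw [hκ, ← mul_div_assoc, ← pow_succ']
          exact div_le_div_of_nonneg_right (pow_le_pow_right₀ hp1.le
            (hΨ.le_finrank_ker_gram hM (by omega) hc₀ hiso)) (by positivity)
        have hd₀ : ∑ i, d₀ i • Ψ i = 0 := (hΨ.sum_smul_eq_zero_iff _).2 ⟨n, fun _ => rfl⟩
        simp only [B, h1]
        rw [hpow j₀ fun i => ⟨hc₀ i, hn i⟩, if_pos hd₀, one_mul, neg_mul]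
        exact neg_le_neg (mul_le_mul_of_nonneg_left hle' (by positivity))
      rw [if_pos h1, if_neg fun h0 => hc₀ ⟨0, by omega⟩ (by
        simpa [j₀] using congrArg Prod.fst (congrFun (h1.symm.trans h0) ⟨0, by omega⟩))]
      linarith
    rw [if_neg h1, add_zero]
    by_cases h0 : j = 0
    · have hR1 : R (fun i => (j i).1) ≤ 1 := by
        refine (div_le_one (by positivity)).2 (pow_le_pow_right₀ hp1.le ?_)
        exact (Submodule.finrank_le _).trans_eq (Module.finrank_fin_fun _)
      have hBj : B j ≤ (1 / 2) ^ t := by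
        simp only [B]
        have : ∏ i, tensorCoeff p δ (j i) = (1 / 2) ^ t := by simp [h0, tensorCoeff]
        rw [this, if_pos (by simp [h0]), one_mul]
        exact mul_le_of_le_one_right (by positivity) (pow_le_one₀ (hR _).le hR1)
      rw [if_pos h0]
      linarith
    rw [if_neg h0, add_zero]
    by_cases h2 : ∑ i, (j i).2 • Ψ i = 0
    swap
    · simp only [B]
      rw [if_neg h2, zero_mul, mul_zero]
      exact hpos.le
    -- The tensor structure kills mixed frequencies, so the quadratic weights inherit the zero
    -- pattern of the linear row vector.
    by_cases h3 : ∀ i, (j i).1 = 0 ↔ (j i).2 = 0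
    swap
    · push Not at h3
      obtain ⟨i, hi⟩ := h3
      have : tensorCoeff p δ (j i) = 0 := by
        rw [tensorCoeff, if_neg, if_neg]
        · tauto
        · rw [Prod.ext_iff, Prod.fst_zero, Prod.snd_zero]
          tauto
      simp only [B]
      rw [Finset.prod_eq_zero (Finset.mem_univ i) this, zero_mul]
      exact hpos.le
    by_cases h4 : ∃ i, (j i).2 = 0
    · obtain ⟨i, hi⟩ := h4
      have hd : (fun i => (j i).2) ≠ 0 := fun hz =>
        h0 (funext fun i => Prod.ext ((h3 i).2 (congrFun hz i)) (congrFun hz i))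
      have hd' : ∀ l, l ≠ i → (j l).2 ≠ 0 := fun l hl h =>
        hl (hΨ.unique_zero hM hd h2 (i := i) (j := l) hi h)
      have hc' : ∀ l, l ≠ i → (j l).1 ≠ 0 := fun l hl h => hd' l hl ((h3 l).1 h)
      have hprod : ∏ i, tensorCoeff p δ (j i) = 1 / 2 * δ ^ (t - 1) := by
        rw [prod_eq_mul_pow_of_ne (fun i => tensorCoeff p δ (j i)) i (x := 1 / 2) (y := -δ)]
        · rw [Even.neg_pow (by obtain ⟨k, hk⟩ := hodd; exact ⟨k, by omega⟩)]
        · exact if_pos (Prod.ext ((h3 i).2 hi) hi)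
        · intro l hl
          rw [tensorCoeff, if_neg fun h => hd' l hl (by rw [h]; rfl),
            if_pos ⟨hc' l hl, hd' l hl⟩]
      simp only [B]
      rw [hprod, if_pos h2, one_mul]
      refine mul_le_mul_of_nonneg_left (pow_le_pow_left₀ (hR _).le ?_ m) (by positivity)
      exact div_le_div_of_nonneg_right (pow_le_pow_right₀ hp1.le
        (hΨ.finrank_ker_gram_le hM (by omega) hc' ((h3 i).2 hi))) (by positivity)
    · push Not at h4
      have : B j ≤ 0 := by
        simp only [B]
        rw [hpow j fun i => ⟨fun h => h4 i ((h3 i).1 h), h4 i⟩, if_pos h2, one_mul, neg_mul]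
        have := pow_pos (hR fun i => (j i).1) m
        have := pow_pos hδ0 t
        exact neg_nonpos.2 (by positivity)
      linarith
  have hsum := hle.trans (Finset.sum_le_sum fun j (_ : j ∈ Finset.univ) => hB j)
  simp only [Finset.sum_add_distrib, Finset.sum_const, Finset.card_univ, Fintype.card_pi,
    Fintype.card_prod, ZMod.card, Finset.prod_const, Fintype.card_fin, nsmul_eq_mul,
    Finset.sum_ite_eq', Finset.mem_univ, if_true, Nat.cast_pow, Nat.cast_mul] at hsum
  have hδt : δ ^ t = δ ^ (t - 1) * δ := by rw [← pow_succ]; congr 1; omega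
  rw [hδt, mul_pow (p : ℝ) κ] at hsum
  have hX : 0 < δ ^ (t - 1) * κ ^ m := by positivity
  have hP : 0 < ((p : ℝ) * p) ^ t := by positivity
  nlinarith [mul_lt_mul_of_pos_left hm hX, mul_pos hP hX]

end LinFormSystem

theorem theorem1p1 :
    ∃ p₀ : ℕ → ℕ, ∀ (t p D : ℕ) [Fact p.Prime] (Ψ : LinFormSystem p t D)
      (M : Matrix (Fin 2) (Fin t) (ZMod p)),
      M.rank = 2 → Ψ.IsDefinedBy M → IsLinearlyGeneric M →
        (¬ (t = 3 ∧ ∀ i j : Fin t, Ψ i = Ψ j) →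
          ¬ Ψ.IsLocallySidorenko ∧ ¬ Ψ.IsSidorenko) ∧
        (Ψ.IsWeaklyLocallySidorenko →
          Odd t ∧ (p₀ t ≤ p → Ψ.ContainsAdditiveTuple (t - 1))) := by
  -- The random-phase argument works over every prime, so the threshold can be `0`.
  refine ⟨fun _ => 0, fun t p D _ Ψ M hr hΨ hM => ⟨fun hne => ?_, fun h => ?_⟩⟩
  · have key : ¬ Ψ.IsLocallySidorenko := by
      intro h
      have hw := h.isWeaklyLocallySidorenko
      have ht := two_le_of_rank_eq_two hr
      have hodd := hw.odd ht hΨ hM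
      have ht4 := h.lt_four hΨ hM hodd
      obtain rfl : t = 3 := by
        obtain ⟨k, hk⟩ := hodd
        omega
      exact hne ⟨rfl, hw.eq_of_three hΨ hM⟩
    exact ⟨key, fun h => key h.isLocallySidorenko⟩
  · have ht := two_le_of_rank_eq_two hr
    have hodd := h.odd ht hΨ hM
    exact ⟨hodd, fun _ => h.containsAdditiveTuple ht hΨ hM hodd⟩
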